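/- Let $\mathbb K$ be a field and let $q\in\mathbb K$ be non-zero and not a root of unity. Let $A=U_q^+(G_2)$ be the $\mathbb K$-algebra generated by $E_\alpha,E_\beta$ subject to the quantum Serre relations $$E_\alpha^4E_\beta-\begin{bmatrix}4\\1\end{bmatrix}_qE_\alpha^3E_\beta E_\alpha+\begin{bmatrix}4\\2\end{bmatrix}_qE_\alpha^2E_\beta E_\alpha^2-\begin{bmatrix}4\\1\end{bmatrix}_qE_\alpha E_\beta E_\alpha^3+E_\beta E_\alpha^4=0,$$ $$E_\beta^2E_\alpha-\begin{bmatrix}2\\1\end{bmatrix}_{q^3}E_\beta E_\alpha E_\beta+E_\alpha E_\beta^2=0,$$ where $\begin{bmatrix}n\\i\end{bmatrix}_z=\frac{[n]_z!}{[i]_z!\,[n-i]_z!}$ and $[m]_z=\frac{z^m-z^{-m}}{z-z^{-1}}$. Let $E_1=E_\alpha$, $E_6=E_\beta$, and let $E_5,E_3,E_2,E_4\in A$ be the root vectors determined by $$E_6E_1=q^3E_1E_6-q^3E_5,\qquad E_5E_1=qE_1E_5-(1+q^2)E_3,$$ $$E_3E_1=q^{-1}E_1E_3-(q+q^{-1}+q^{-3})E_2,\qquad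 E_5E_3=q^{-1}E_3E_5-(q+q^{-1}+q^{-3})E_4 .$$ Put $$\Omega_1=E_1E_3E_5+aE_1E_4+aE_2E_5+a'E_3^2,$$ $$\Omega_2=E_2E_4E_6+bE_2E_5^3+bE_3^3E_6+b'E_3^2E_5^2+c'E_3E_4E_5+d'E_4^2,$$ where $$a=\tfrac{q^2+1+q^{-2}}{q^{-2}-1},\quad b=-\tfrac{q^7-2q^5+q^3}{(q^4+q^2+1)(1-q^{-6})},\quad a'=\tfrac{q^6}{q^2-1},\quad b'=\tfrac{q^{13}-q^{11}}{(q^4+q^2+1)^2},\quad c'=-\tfrac{q^9}{q^4+q^2+1},\quad d'=\tfrac{q^{12}}{q^6-1}.$$ Then the centre of $A$ is the polynomial algebra $Z(A)=\mathbb K[\Omega_1,\Omega_2]$: it is generated by $\Omega_1$ and $\Omega_2$, which are algebraically independent over $\mathbb K$. Moreover $A$ has a skew field of fractions $F=\operatorname{Fract}(A)$, and in it $\Omega_1=T_1T_3T_5$ and $\Omega_2=T_2T_4T_6$, where $T_1,\dots,T_6\in F$ are the elements produced by the deleting derivations algorithm: $$E_{1,6}=E_1+rE_5E_6^{-1},\quad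 E_{2,6}=E_2+tE_3E_5E_6^{-1}+uE_4E_6^{-1}+nE_5^3E_6^{-2},\quad E_{3,6}=E_3+sE_5^2E_6^{-1},$$ $$T_6=E_6,\qquad T_5=E_5,\qquad T_4=E_4+bE_5^3E_6^{-1},\qquad T_3=E_{3,6}+aT_4T_5^{-1},$$ $$E_{1,5}=E_{1,6}+hE_{3,6}T_5^{-1}+gT_4T_5^{-2},\qquad E_{2,5}=E_{2,6}+fE_{3,6}^2T_5^{-1}+pE_{3,6}T_4T_5^{-2}+eT_4^2T_5^{-3},$$ $$E_{1,4}=E_{1,5}+sT_3^2T_4^{-1},\qquad T_2=E_{2,5}+bT_3^3T_4^{-1},\qquad T_1=E_{1,4}+aT_2T_3^{-1},$$ with $$r=\tfrac{-1}{1-q^{-6}},\quad t=\tfrac{q^{-1}-q}{1-q^{-6}},\quad u=\tfrac{q+q^{-1}-q^{-3}}{1-q^{-6}},\quad n=\tfrac{q^{12}}{(q^4+q^2+1)^3},\quad s=\tfrac{1-q^2}{1-q^{-6}},\quad h=\tfrac{q+q^{-1}}{q^{-2}-1},$$ $$g=\tfrac{q+q^{-1}+q^{-3}}{(1-q^{-2})^2},\quad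 f=\tfrac{1-q^2}{1-q^{-2}},\quad p=\tfrac{q^4+q^2+1}{q^2-1},\quad e=\tfrac{-(q^7+q^5+q^3)}{q^4-2q^2+1}.$$ -/

import Mathlib

universe u v

noncomputable section

namespace QG2

/-! ### Symmetric quantum integers and quantum binomial coefficients -/

/-- `[n]_z = (z ^ n - z ^ (-n)) / (z - z⁻¹)`. -/
def qInt {K : Type u} [Field K] (z : K) (n : ℕ) : K :=
  (z ^ n - z⁻¹ ^ n) / (z - z⁻¹)

/-- `[n]_z! = [1]_z [2]_z ⋯ [n]_z`. -/
def qFactorial {K : Type u} [Field K] (z : K) (n : ℕ) : K :=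
  ∏ i ∈ Finset.range n, qInt z (i + 1)

/-- The quantum binomial coefficient `[n]_z! / ([i]_z! [n-i]_z!)`, for `i ≤ n`. -/
def qBinom {K : Type u} [Field K] (z : K) (n i : ℕ) : K :=
  qFactorial z n / (qFactorial z i * qFactorial z (n - i))

/-! ### The algebra `U_q^+(G_2)` -/

/-- The two simple roots of `G_2`: `α` is short, `β` is long. -/
inductive SimpleRoot : Type
  | α
  | β

/-- The free generator attached to the short simple root. -/
def freeα (K : Type u) [Field K] : FreeAlgebra K SimpleRoot := FreeAlgebra.ι K SimpleRoot.α

/-- The free generator attached to the long simple root. -/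
def freeβ (K : Type u) [Field K] : FreeAlgebra K SimpleRoot := FreeAlgebra.ι K SimpleRoot.β

/-- The quantum Serre relations of type `G_2`. -/
inductive SerreRel {K : Type u} [Field K] (q : K) :
    FreeAlgebra K SimpleRoot → FreeAlgebra K SimpleRoot → Prop
  | s1 : SerreRel q
      (freeα K ^ 4 * freeβ K
        - qBinom q 4 1 • (freeα K ^ 3 * freeβ K * freeα K)
        + qBinom q 4 2 • (freeα K ^ 2 * freeβ K * freeα K ^ 2)
        - qBinom q 4 1 • (freeα K * freeβ K * freeα K ^ 3)
        + freeβ K * freeα K ^ 4) 0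
  | s2 : SerreRel q
      (freeβ K ^ 2 * freeα K
        - qBinom (q ^ 3) 2 1 • (freeβ K * freeα K * freeβ K)
        + freeα K * freeβ K ^ 2) 0

/-- `U_q^+(G_2)`: the `K`-algebra on `E_α`, `E_β` with the quantum Serre relations. -/
abbrev UqPlus {K : Type u} [Field K] (q : K) : Type u := RingQuot (SerreRel q)

/-! ### Root vectors

`E₁ = E_α` and `E₆ = E_β` are the generators. The remaining root vectors
`E₂ = E_{3α+β}`, `E₃ = E_{2α+β}`, `E₄ = E_{3α+2β}`, `E₅ = E_{α+β}` are given by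
`q`-commutators, so that
* `E₆ E₁ = q ^ 3 E₁ E₆ - q ^ 3 E₅`,
* `E₅ E₁ = q E₁ E₅ - (1 + q ^ 2) E₃`,
* `E₃ E₁ = q⁻¹ E₁ E₃ - (q + q⁻¹ + q⁻³) E₂`,
* `E₅ E₃ = q⁻¹ E₃ E₅ - (q + q⁻¹ + q⁻³) E₄`. -/

/-- `E₁ = E_α`. -/
def E1 {K : Type u} [Field K] (q : K) : UqPlus q :=
  RingQuot.mkAlgHom K (SerreRel q) (freeα K)

/-- `E₆ = E_β`. -/
def E6 {K : Type u} [Field K] (q : K) : UqPlus q :=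
  RingQuot.mkAlgHom K (SerreRel q) (freeβ K)

/-- `E₅ = E_{α+β}`. -/
def E5 {K : Type u} [Field K] (q : K) : UqPlus q :=
  E1 q * E6 q - (q ^ 3)⁻¹ • (E6 q * E1 q)

/-- `E₃ = E_{2α+β}`. -/
def E3 {K : Type u} [Field K] (q : K) : UqPlus q :=
  (1 + q ^ 2)⁻¹ • (q • (E1 q * E5 q) - E5 q * E1 q)

/-- `E₂ = E_{3α+β}`. -/
def E2 {K : Type u} [Field K] (q : K) : UqPlus q :=
  (q + q⁻¹ + (q ^ 3)⁻¹)⁻¹ • (q⁻¹ • (E1 q * E3 q) - E3 q * E1 q)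

/-- `E₄ = E_{3α+2β}`. -/
def E4 {K : Type u} [Field K] (q : K) : UqPlus q :=
  (q + q⁻¹ + (q ^ 3)⁻¹)⁻¹ • (q⁻¹ • (E3 q * E5 q) - E5 q * E3 q)

/-! ### Scalars -/

def cA {K : Type u} [Field K] (q : K) : K := (q ^ 2 + 1 + (q ^ 2)⁻¹) / ((q ^ 2)⁻¹ - 1)

def cB {K : Type u} [Field K] (q : K) : K :=
  -((q ^ 7 - 2 * q ^ 5 + q ^ 3) / ((q ^ 4 + q ^ 2 + 1) * (1 - (q ^ 6)⁻¹)))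

def cE {K : Type u} [Field K] (q : K) : K :=
  -(q ^ 7 + q ^ 5 + q ^ 3) / (q ^ 4 - 2 * q ^ 2 + 1)

def cF {K : Type u} [Field K] (q : K) : K := (1 - q ^ 2) / (1 - (q ^ 2)⁻¹)

def cG {K : Type u} [Field K] (q : K) : K :=
  (q + q⁻¹ + (q ^ 3)⁻¹) / (1 - (q ^ 2)⁻¹) ^ 2

def cH {K : Type u} [Field K] (q : K) : K := (q + q⁻¹) / ((q ^ 2)⁻¹ - 1)

def cN {K : Type u} [Field K] (q : K) : K := q ^ 12 / (q ^ 4 + q ^ 2 + 1) ^ 3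

def cP {K : Type u} [Field K] (q : K) : K := (q ^ 4 + q ^ 2 + 1) / (q ^ 2 - 1)

def cR {K : Type u} [Field K] (q : K) : K := -1 / (1 - (q ^ 6)⁻¹)

def cS {K : Type u} [Field K] (q : K) : K := (1 - q ^ 2) / (1 - (q ^ 6)⁻¹)

def cT {K : Type u} [Field K] (q : K) : K := (q⁻¹ - q) / (1 - (q ^ 6)⁻¹)

def cU {K : Type u} [Field K] (q : K) : K := (q + q⁻¹ - (q ^ 3)⁻¹) / (1 - (q ^ 6)⁻¹)

def cA' {K : Type u} [Field K] (q : K) : K := q ^ 6 / (q ^ 2 - 1)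

def cB' {K : Type u} [Field K] (q : K) : K := (q ^ 13 - q ^ 11) / (q ^ 4 + q ^ 2 + 1) ^ 2

def cC' {K : Type u} [Field K] (q : K) : K := -(q ^ 9 / (q ^ 4 + q ^ 2 + 1))

def cD' {K : Type u} [Field K] (q : K) : K := q ^ 12 / (q ^ 6 - 1)

/-! ### The elements `Ω₁` and `Ω₂` of `U_q^+(G_2)` -/

/-- `Ω₁ = E₁E₃E₅ + a E₁E₄ + a E₂E₅ + a' E₃²`. -/
def Omega1 {K : Type u} [Field K] (q : K) : UqPlus q :=
  E1 q * E3 q * E5 q + cA q • (E1 q * E4 q) + cA q • (E2 q * E5 q) + cA' q • E3 q ^ 2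

/-- `Ω₂ = E₂E₄E₆ + b E₂E₅³ + b E₃³E₆ + b' E₃²E₅² + c' E₃E₄E₅ + d' E₄²`. -/
def Omega2 {K : Type u} [Field K] (q : K) : UqPlus q :=
  E2 q * E4 q * E6 q + cB q • (E2 q * E5 q ^ 3) + cB q • (E3 q ^ 3 * E6 q)
    + cB' q • (E3 q ^ 2 * E5 q ^ 2) + cC' q • (E3 q * E4 q * E5 q) + cD' q • E4 q ^ 2

/-! ### Skew field of fractions and the deleting derivations algorithm -/

/-- `ι : A → F` exhibits the division ring `F` as a skew field of fractions of `A`: it is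
injective, and every element of `F` is a fraction `s⁻¹ a` with `a, s ∈ A` and `s ≠ 0`. -/
structure IsSkewFieldOfFractions {K : Type u} [Field K] {A : Type u} [Ring A] [Algebra K A]
    {F : Type v} [DivisionRing F] [Algebra K F] (ι : A →ₐ[K] F) : Prop where
  injective : Function.Injective ι
  exists_fraction : ∀ x : F, ∃ a s : A, s ≠ 0 ∧ x = (ι s)⁻¹ * ι a

/-- A sextuple `(E_{1,j}, …, E_{6,j})` of elements occurring in the algorithm. -/
@[ext]
structure Sextuple (F : Type v) : Type v where
  x1 : F
  x2 : F
  x3 : F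
  x4 : F
  x5 : F
  x6 : F

/-- The initial data `(E_{1,7}, …, E_{6,7}) = (E₁, …, E₆)`. -/
def dda7 {K : Type u} [Field K] (q : K) {F : Type v} [DivisionRing F] [Algebra K F]
    (ι : UqPlus q →ₐ[K] F) : Sextuple F where
  x1 := ι (E1 q)
  x2 := ι (E2 q)
  x3 := ι (E3 q)
  x4 := ι (E4 q)
  x5 := ι (E5 q)
  x6 := ι (E6 q)

/-- Passage from `E_{i,7}` to `E_{i,6}`. -/
def ddaStep6 {K : Type u} [Field K] (q : K) {F : Type v} [DivisionRing F] [Algebra K F]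
    (X : Sextuple F) : Sextuple F where
  x1 := X.x1 + cR q • (X.x5 * X.x6⁻¹)
  x2 := X.x2 + cT q • (X.x3 * X.x5 * X.x6⁻¹) + cU q • (X.x4 * X.x6⁻¹)
    + cN q • (X.x5 ^ 3 * X.x6⁻¹ ^ 2)
  x3 := X.x3 + cS q • (X.x5 ^ 2 * X.x6⁻¹)
  x4 := X.x4 + cB q • (X.x5 ^ 3 * X.x6⁻¹)
  x5 := X.x5
  x6 := X.x6

/-- Passage from `E_{i,6}` to `E_{i,5}`. -/
def ddaStep5 {K : Type u} [Field K] (q : K) {F : Type v} [DivisionRing F] [Algebra K F]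
    (X : Sextuple F) : Sextuple F where
  x1 := X.x1 + cH q • (X.x3 * X.x5⁻¹) + cG q • (X.x4 * X.x5⁻¹ ^ 2)
  x2 := X.x2 + cF q • (X.x3 ^ 2 * X.x5⁻¹) + cP q • (X.x3 * X.x4 * X.x5⁻¹ ^ 2)
    + cE q • (X.x4 ^ 2 * X.x5⁻¹ ^ 3)
  x3 := X.x3 + cA q • (X.x4 * X.x5⁻¹)
  x4 := X.x4
  x5 := X.x5
  x6 := X.x6

/-- Passage from `E_{i,5}` to `E_{i,4}`. -/
def ddaStep4 {K : Type u} [Field K] (q : K) {F : Type v} [DivisionRing F] [Algebra K F]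
    (X : Sextuple F) : Sextuple F where
  x1 := X.x1 + cS q • (X.x3 ^ 2 * X.x4⁻¹)
  x2 := X.x2 + cB q • (X.x3 ^ 3 * X.x4⁻¹)
  x3 := X.x3
  x4 := X.x4
  x5 := X.x5
  x6 := X.x6

/-- Passage from `E_{i,4}` to `E_{i,3}`. -/
def ddaStep3 {K : Type u} [Field K] (q : K) {F : Type v} [DivisionRing F] [Algebra K F]
    (X : Sextuple F) : Sextuple F where
  x1 := X.x1 + cA q • (X.x2 * X.x3⁻¹)
  x2 := X.x2
  x3 := X.x3
  x4 := X.x4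
  x5 := X.x5
  x6 := X.x6

/-- The final sextuple `(T₁, …, T₆)`; the last step, from `E_{i,3}` to `E_{i,2}`, changes
nothing. -/
def ddaT {K : Type u} [Field K] (q : K) {F : Type v} [DivisionRing F] [Algebra K F]
    (ι : UqPlus q →ₐ[K] F) : Sextuple F :=
  ddaStep3 q (ddaStep4 q (ddaStep5 q (ddaStep6 q (dda7 q ι))))

end QG2

end

universe w

noncomputable section

namespace QG2

set_option linter.unusedSimpArgs false
set_option linter.unnecessarySeqFocus false

/-! ### Nonvanishing of the scalars -/

section Scalars

variable {K : Type u} [Field K] {q : K}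

/-! The algebra A = U_q^+(G₂) is embedded in a quantum torus, where centrality, zero divisors and
the Ωᵢ are read off from exponents. Inverting the deleting derivations algorithm writes E₁, …, E₆ as
explicit Laurent polynomials `e1`, …, `e6` in q-commuting variables T₁, …, T₆. Each Serre relator
factors into iterated q-commutators (`serre_short_eq`, `serre_long_eq`), so, given the definitions
of the root vectors, the Serre relations amount to E₂E₁ = q⁻³E₁E₂ and E₆E₅ = q⁻³E₅E₆. Six identities
between Laurent polynomials therefore give the homomorphism `toTorus`, and it sends Ω₁ and Ω₂ to the
monomials T₁T₃T₅ and T₂T₄T₆.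

Injectivity needs no PBW basis known beforehand. The nine other straightening relations follow from
the six by comparing the two ways of associating a triple product, so the ordered monomials in E₁,
…, E₆ span A. Their images have distinct lexicographic leading exponents, hence are independent. So
A is a domain, and the image of a nonzero element has its leading exponent in ℕ⁶
(`exists_hasLead_toTorus`).

A central element commutes with every Tᵢ by triangularity of the eᵢ. As q is not a root of unity,
its exponents lie in the radical of the commutation form, ℤ(1,0,1,0,1,0) + ℤ(0,1,0,1,0,1). Its
leading exponent is moreover nonnegative, so it is that of some Ω₁^i Ω₂^j, whose image is a multiple
of a single monomial; subtracting shrinks the support, and induction gives the centre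
(`center_le_adjoin_omega`). Distinct leading exponents also give algebraic independence.

Polynomial growth of the torus forces the Ore condition on A and on the torus (`exists_mul_eq_mul`).
Any skew field of fractions F of A then embeds in the one of the torus. The algorithm uses only
field operations, so it may be run there, where it returns T₁, …, T₆; the product formulas pull back
to F (`omega_eq_prod`). -/

theorem sq_sub_one_ne_zero (hq : ∀ n : ℕ, 0 < n → q ^ n ≠ 1) : q ^ 2 - 1 ≠ 0 :=
  sub_ne_zero.2 (hq 2 (by norm_num))

theorem one_add_sq_ne_zero (hq : ∀ n : ℕ, 0 < n → q ^ n ≠ 1) : 1 + q ^ 2 ≠ 0 := by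
  intro h
  exact hq 4 (by norm_num) (by linear_combination (q ^ 2 - 1) * h)

theorem cyclotomic_ne_zero (hq : ∀ n : ℕ, 0 < n → q ^ n ≠ 1) : q ^ 4 + q ^ 2 + 1 ≠ 0 := by
  intro h
  exact hq 6 (by norm_num) (by linear_combination (q ^ 2 - 1) * h)

/-- The Horner form is the shape in which `field_simp` meets this denominator. -/
theorem cyclotomic_ne_zero_horner (hq : ∀ n : ℕ, 0 < n → q ^ n ≠ 1) :
    q ^ 2 * (q ^ 2 + 1) + 1 ≠ 0 := by
  convert cyclotomic_ne_zero hq using 1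
  ring

/-- This factor of q⁸ - 1, and the factor q⁴ - q² + 1 of q¹² - 1 below, are divided out when overlap
identities are solved for a product in `r32`, `r43` and `r54`. -/
theorem fourth_add_one_ne_zero (hq : ∀ n : ℕ, 0 < n → q ^ n ≠ 1) : q ^ 4 + 1 ≠ 0 := by
  intro h
  exact hq 8 (by norm_num) (by linear_combination (q ^ 4 - 1) * h)

theorem cyclotomic_twelve_ne_zero (hq : ∀ n : ℕ, 0 < n → q ^ n ≠ 1) :
    q ^ 2 * (q ^ 2 - 1) + 1 ≠ 0 := by
  intro h
  exact hq 12 (by norm_num) (by linear_combination (q ^ 2 + 1) * (q ^ 6 - 1) * h)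

theorem k_eq (hq0 : q ≠ 0) : q + q⁻¹ + (q ^ 3)⁻¹ = (q ^ 4 + q ^ 2 + 1) / q ^ 3 := by
  field_simp

theorem qInt_one (h : q - q⁻¹ ≠ 0) : qInt q 1 = 1 := by
  simp [qInt, div_self h]

theorem qInt_eq_of_mul_eq {n : ℕ} {c : K} (h : q - q⁻¹ ≠ 0)
    (hc : c * (q - q⁻¹) = q ^ n - q⁻¹ ^ n) : qInt q n = c := by
  rw [qInt, ← hc, mul_div_cancel_right₀ _ h]

theorem sub_inv_ne_zero (hq0 : q ≠ 0) (h : q ^ 2 - 1 ≠ 0) : q - q⁻¹ ≠ 0 := by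
  intro h'
  apply h
  field_simp at h'
  linear_combination h'

theorem qInt_two (h : q - q⁻¹ ≠ 0) : qInt q 2 = q + q⁻¹ :=
  qInt_eq_of_mul_eq h (by ring)

theorem qBinom_two_one (h : q - q⁻¹ ≠ 0) : qBinom q 2 1 = q + q⁻¹ := by
  simp [qBinom, qFactorial, Finset.prod_range_succ, qInt_one h, qInt_two h]

theorem qInt_three (hq0 : q ≠ 0) (h : q - q⁻¹ ≠ 0) :
    qInt q 3 = (q ^ 4 + q ^ 2 + 1) / q ^ 2 :=
  qInt_eq_of_mul_eq h (by field_simp; ring)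

theorem qInt_four (hq0 : q ≠ 0) (h : q - q⁻¹ ≠ 0) :
    qInt q 4 = (1 + q ^ 2) * (1 + q ^ 4) / q ^ 3 :=
  qInt_eq_of_mul_eq h (by field_simp; ring)

theorem qBinom_four_one (hq0 : q ≠ 0) (hq : ∀ n : ℕ, 0 < n → q ^ n ≠ 1) :
    qBinom q 4 1 = (1 + q ^ 2) * (1 + q ^ 4) / q ^ 3 := by
  have h := sub_inv_ne_zero hq0 (sq_sub_one_ne_zero hq)
  have h2 := one_add_sq_ne_zero hq
  have h3 := cyclotomic_ne_zero_horner hq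
  have h2' : q + q⁻¹ = (1 + q ^ 2) / q := by field_simp; ring
  simp only [qBinom, qFactorial, Finset.prod_range_succ, Finset.prod_range_zero, zero_add, one_mul,
    Nat.reduceAdd, Nat.reduceSub, qInt_one h, qInt_two h, qInt_three hq0 h, qInt_four hq0 h, h2']
  field_simp

theorem qBinom_four_two (hq0 : q ≠ 0) (hq : ∀ n : ℕ, 0 < n → q ^ n ≠ 1) :
    qBinom q 4 2 = (q ^ 4 + q ^ 2 + 1) * (1 + q ^ 4) / q ^ 4 := by
  have h := sub_inv_ne_zero hq0 (sq_sub_one_ne_zero hq)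
  have h2 := one_add_sq_ne_zero hq
  have h3 := cyclotomic_ne_zero_horner hq
  have h2' : q + q⁻¹ = (1 + q ^ 2) / q := by field_simp; ring
  simp only [qBinom, qFactorial, Finset.prod_range_succ, Finset.prod_range_zero, zero_add, one_mul,
    Nat.reduceAdd, Nat.reduceSub, qInt_one h, qInt_two h, qInt_three hq0 h, qInt_four hq0 h, h2']
  field_simp

end Scalars

/-! ### The Serre relations in terms of root vectors -/

section Serre

variable {K : Type u} [Field K] {q : K} {R : Type v} [Ring R] [Algebra K R]

/-- With L and R the commuting left and right multiplications by x₆, the relator is (R - q³L)(R -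
q⁻³L) applied to x₁, and x₅ is the inner factor applied to x₁. -/
theorem serre_long_eq (hq0 : q ≠ 0) (hq : ∀ n : ℕ, 0 < n → q ^ n ≠ 1) {x₁ x₅ x₆ : R}
    (h5 : x₅ = x₁ * x₆ - (q ^ 3)⁻¹ • (x₆ * x₁)) :
    x₆ ^ 2 * x₁ - qBinom (q ^ 3) 2 1 • (x₆ * x₁ * x₆) + x₁ * x₆ ^ 2
      = x₅ * x₆ - q ^ 3 • (x₆ * x₅) := by
  have h : q ^ 3 - (q ^ 3)⁻¹ ≠ 0 := by
    refine sub_inv_ne_zero (pow_ne_zero 3 hq0) (sub_ne_zero.2 ?_)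
    rw [← pow_mul]
    exact hq _ (by norm_num)
  rw [qBinom_two_one h, h5]
  simp only [pow_two, mul_assoc, mul_sub, sub_mul, smul_mul_assoc, mul_smul_comm]
  match_scalars <;> field_simp <;> ring

/-- With L and R the left and right multiplications by x₁, the q-binomial theorem factors the
relator as the product of L - q^j R over j = -3, -1, 1, 3, applied to x₆. The first three factors
produce x₅, x₃, x₂ up to scalars; the last is the q-commutator on the right. -/
theorem serre_short_eq (hq0 : q ≠ 0) (hq : ∀ n : ℕ, 0 < n → q ^ n ≠ 1) {x₁ x₂ x₃ x₅ x₆ : R}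
    (h5 : x₅ = x₁ * x₆ - (q ^ 3)⁻¹ • (x₆ * x₁))
    (h3 : x₃ = (1 + q ^ 2)⁻¹ • (q • (x₁ * x₅) - x₅ * x₁))
    (h2 : x₂ = (q + q⁻¹ + (q ^ 3)⁻¹)⁻¹ • (q⁻¹ • (x₁ * x₃) - x₃ * x₁)) :
    x₁ ^ 4 * x₆ - qBinom q 4 1 • (x₁ ^ 3 * x₆ * x₁) + qBinom q 4 2 • (x₁ ^ 2 * x₆ * x₁ ^ 2)
        - qBinom q 4 1 • (x₁ * x₆ * x₁ ^ 3) + x₆ * x₁ ^ 4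
      = ((1 + q ^ 2) * (q ^ 4 + q ^ 2 + 1)) •
        ((q ^ 3)⁻¹ • (x₁ * x₂) - x₂ * x₁) := by
  have hS := one_add_sq_ne_zero hq
  have hW := cyclotomic_ne_zero_horner hq
  rw [qBinom_four_one hq0 hq, qBinom_four_two hq0 hq, h2, h3, h5, k_eq hq0]
  simp only [pow_succ, pow_zero, one_mul, mul_assoc, mul_sub, sub_mul, smul_mul_assoc,
    mul_smul_comm]
  match_scalars <;> field_simp <;> ring

end Serre

/-! ### Straightening relations between root vectors -/

/-- Elements `x₁, …, x₆` of an algebra satisfying the defining relations of root vectors and the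
two relations equivalent to the quantum Serre relations. The relation `rji` straightens
`xⱼ * xᵢ`. -/
structure RootVectorRelations {K : Type u} [Field K] (q : K) {R : Type v} [Ring R] [Algebra K R]
    (x₁ x₂ x₃ x₄ x₅ x₆ : R) : Prop where
  r61 : x₆ * x₁ = q ^ 3 • (x₁ * x₆) - q ^ 3 • x₅
  r51 : x₅ * x₁ = q • (x₁ * x₅) - (1 + q ^ 2) • x₃
  r31 : x₃ * x₁ = q⁻¹ • (x₁ * x₃) - ((q ^ 4 + q ^ 2 + 1) / q ^ 3) • x₂
  r53 : x₅ * x₃ = q⁻¹ • (x₃ * x₅) - ((q ^ 4 + q ^ 2 + 1) / q ^ 3) • x₄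
  r65 : x₆ * x₅ = (q ^ 3)⁻¹ • (x₅ * x₆)
  r21 : x₂ * x₁ = (q ^ 3)⁻¹ • (x₁ * x₂)

/-- Lets a straightening rule act inside a right-associated product. -/
theorem mul_mul_of_mul_eq {R : Type v} [Ring R] {a b c : R} (h : a * b = c) (x : R) :
    a * (b * x) = c * x := by
  rw [← mul_assoc, h]

/-! ### The nine remaining straightening relations, from associativity overlaps. -/

namespace RootVectorRelations

variable {K : Type u} [Field K] {q : K} {R : Type v} [Ring R] [Algebra K R]
  {x₁ x₂ x₃ x₄ x₅ x₆ : R}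

/-- Straightening x₆x₅x₁ from the left and from the right must agree. The comparison is linear in
the one product not yet known, x₆x₃, whose coefficient is invertible. The relations below follow the
same pattern, each using those already found. -/
theorem r63 (H : RootVectorRelations q x₁ x₂ x₃ x₄ x₅ x₆) (hq0 : q ≠ 0)
    (hq : ∀ n : ℕ, 0 < n → q ^ n ≠ 1) :
    x₆ * x₃ = x₃ * x₆ + (1 - q ^ 2) • (x₅ * x₅) := by
  have hS := one_add_sq_ne_zero hq
  have hW := cyclotomic_ne_zero_horner hq
  have h := mul_assoc x₆ x₅ x₁
  rw [H.r65, H.r51] at h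
  simp only [mul_sub, sub_mul, mul_add, add_mul, mul_smul_comm, smul_mul_assoc, mul_assoc,
    H.r61, H.r65, H.r51,
    mul_mul_of_mul_eq H.r61, mul_mul_of_mul_eq H.r65, mul_mul_of_mul_eq H.r51] at h
  linear_combination (norm := skip) (1 + q ^ 2)⁻¹ • h
  match_scalars <;> field_simp <;> ring

theorem r64 (H : RootVectorRelations q x₁ x₂ x₃ x₄ x₅ x₆) (hq0 : q ≠ 0)
    (hq : ∀ n : ℕ, 0 < n → q ^ n ≠ 1) :
    x₆ * x₄ = (q ^ 3)⁻¹ • (x₄ * x₆)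
      - ((q ^ 2 - 1) ^ 2 / (q ^ 4 + q ^ 2 + 1)) • (x₅ * (x₅ * x₅)) := by
  have hS := one_add_sq_ne_zero hq
  have hW := cyclotomic_ne_zero_horner hq
  have h63 := H.r63 hq0 hq
  have h := mul_assoc x₆ x₅ x₃
  rw [H.r65, H.r53] at h
  simp only [mul_sub, sub_mul, mul_add, add_mul, mul_smul_comm, smul_mul_assoc, mul_assoc,
    H.r65, H.r53, h63,
    mul_mul_of_mul_eq H.r65, mul_mul_of_mul_eq H.r53, mul_mul_of_mul_eq h63] at h
  linear_combination (norm := skip) ((q ^ 4 + q ^ 2 + 1) / q ^ 3)⁻¹ • h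
  match_scalars <;> field_simp <;> ring

theorem r62 (H : RootVectorRelations q x₁ x₂ x₃ x₄ x₅ x₆) (hq0 : q ≠ 0)
    (hq : ∀ n : ℕ, 0 < n → q ^ n ≠ 1) :
    x₆ * x₂ = q ^ 3 • (x₂ * x₆) + (q ^ 4 + q ^ 2 - 1) • x₄ + (q ^ 2 - q ^ 4) • (x₃ * x₅) := by
  have hS := one_add_sq_ne_zero hq
  have hW := cyclotomic_ne_zero_horner hq
  have h63 := H.r63 hq0 hq
  have h := mul_assoc x₆ x₃ x₁
  rw [h63, H.r31] at h
  simp only [mul_sub, sub_mul, mul_add, add_mul, mul_smul_comm, smul_mul_assoc, mul_assoc,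
    H.r61, H.r31, H.r51, H.r53, h63,
    mul_mul_of_mul_eq H.r61, mul_mul_of_mul_eq H.r31, mul_mul_of_mul_eq H.r51,
    mul_mul_of_mul_eq H.r53, mul_mul_of_mul_eq h63] at h
  linear_combination (norm := skip) ((q ^ 4 + q ^ 2 + 1) / q ^ 3)⁻¹ • h
  match_scalars <;> field_simp <;> ring

/-- The overlap x₆x₂x₁ involves two unknown products, x₄x₁ and x₅x₂. The overlap x₅x₃x₁ involves the
same two, and serves to eliminate x₅x₂. -/
theorem r41 (H : RootVectorRelations q x₁ x₂ x₃ x₄ x₅ x₆) (hq0 : q ≠ 0)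
    (hq : ∀ n : ℕ, 0 < n → q ^ n ≠ 1) :
    x₄ * x₁ = x₁ * x₄ + (1 - q ^ 2) • (x₃ * x₃) := by
  have hS := one_add_sq_ne_zero hq
  have hW := cyclotomic_ne_zero_horner hq
  have h62 := H.r62 hq0 hq
  have h := mul_assoc x₆ x₂ x₁
  rw [h62, H.r21] at h
  simp only [mul_sub, sub_mul, mul_add, add_mul, mul_smul_comm, smul_mul_assoc, mul_assoc,
    H.r61, H.r21, H.r31, H.r51, H.r53, H.r65, h62,
    mul_mul_of_mul_eq H.r61, mul_mul_of_mul_eq H.r21, mul_mul_of_mul_eq H.r31,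
    mul_mul_of_mul_eq H.r51, mul_mul_of_mul_eq H.r53, mul_mul_of_mul_eq H.r65,
    mul_mul_of_mul_eq h62] at h
  have h' := mul_assoc x₅ x₃ x₁
  rw [H.r53, H.r31] at h'
  simp only [mul_sub, sub_mul, mul_smul_comm, smul_mul_assoc, mul_assoc, H.r51, H.r53,
    mul_mul_of_mul_eq H.r51, mul_mul_of_mul_eq H.r31] at h'
  linear_combination (norm := skip) (q ^ 2 * (1 + q ^ 2))⁻¹ • h
    - ((q ^ 2 * (1 + q ^ 2))⁻¹ * ((q ^ 4 + q ^ 2 + 1) / q ^ 3)⁻¹) • h'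
  match_scalars <;> field_simp <;> ring

/-- The overlap x₅x₃x₁ again, now that x₄x₁ is known. -/
theorem r52 (H : RootVectorRelations q x₁ x₂ x₃ x₄ x₅ x₆) (hq0 : q ≠ 0)
    (hq : ∀ n : ℕ, 0 < n → q ^ n ≠ 1) :
    x₅ * x₂ = x₂ * x₅ + (1 - q ^ 2) • (x₃ * x₃) := by
  have hS := one_add_sq_ne_zero hq
  have hW := cyclotomic_ne_zero_horner hq
  have h41 := H.r41 hq0 hq
  have h := mul_assoc x₅ x₃ x₁
  rw [H.r53, H.r31] at h
  simp only [mul_sub, sub_mul, mul_add, add_mul, mul_smul_comm, smul_mul_assoc, mul_assoc,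
    H.r31, H.r51, H.r53, h41,
    mul_mul_of_mul_eq H.r31, mul_mul_of_mul_eq H.r51, mul_mul_of_mul_eq H.r53,
    mul_mul_of_mul_eq h41] at h
  linear_combination (norm := skip) ((q ^ 4 + q ^ 2 + 1) / q ^ 3)⁻¹ • h
  match_scalars <;> field_simp <;> ring

/-- In the overlap x₅x₂x₁ the product x₃x₂ has coefficient (q⁴ + 1)/q. -/
theorem r32 (H : RootVectorRelations q x₁ x₂ x₃ x₄ x₅ x₆) (hq0 : q ≠ 0)
    (hq : ∀ n : ℕ, 0 < n → q ^ n ≠ 1) :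
    x₃ * x₂ = (q ^ 3)⁻¹ • (x₂ * x₃) := by
  have hS := one_add_sq_ne_zero hq
  have hW := cyclotomic_ne_zero_horner hq
  have hF := fourth_add_one_ne_zero hq
  have h52 := H.r52 hq0 hq
  have h := mul_assoc x₅ x₂ x₁
  rw [h52, H.r21] at h
  simp only [mul_sub, sub_mul, mul_add, add_mul, mul_smul_comm, smul_mul_assoc, mul_assoc,
    H.r31, H.r51, H.r53, H.r21, h52,
    mul_mul_of_mul_eq H.r31, mul_mul_of_mul_eq H.r51, mul_mul_of_mul_eq H.r53,
    mul_mul_of_mul_eq H.r21, mul_mul_of_mul_eq h52] at h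
  linear_combination (norm := skip) (q / (q ^ 4 + 1)) • h
  match_scalars <;> field_simp <;> ring

theorem r54 (H : RootVectorRelations q x₁ x₂ x₃ x₄ x₅ x₆) (hq0 : q ≠ 0)
    (hq : ∀ n : ℕ, 0 < n → q ^ n ≠ 1) :
    x₅ * x₄ = (q ^ 3)⁻¹ • (x₄ * x₅) := by
  have hS := one_add_sq_ne_zero hq
  have hW := cyclotomic_ne_zero_horner hq
  have hT := cyclotomic_twelve_ne_zero hq
  have h64 := H.r64 hq0 hq
  have h41 := H.r41 hq0 hq
  have h63 := H.r63 hq0 hq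
  have h := mul_assoc x₆ x₄ x₁
  rw [h64, h41] at h
  simp only [mul_sub, sub_mul, mul_add, add_mul, mul_smul_comm, smul_mul_assoc, mul_assoc,
    H.r61, H.r31, H.r51, H.r53, H.r65, h64, h41, h63,
    mul_mul_of_mul_eq H.r61, mul_mul_of_mul_eq H.r31, mul_mul_of_mul_eq H.r51,
    mul_mul_of_mul_eq H.r53, mul_mul_of_mul_eq H.r65, mul_mul_of_mul_eq h64,
    mul_mul_of_mul_eq h41, mul_mul_of_mul_eq h63] at h
  linear_combination (norm := skip) (q * (q ^ 4 - q ^ 2 + 1))⁻¹ • h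
  match_scalars <;> field_simp <;> ring

theorem r43 (H : RootVectorRelations q x₁ x₂ x₃ x₄ x₅ x₆) (hq0 : q ≠ 0)
    (hq : ∀ n : ℕ, 0 < n → q ^ n ≠ 1) :
    x₄ * x₃ = (q ^ 3)⁻¹ • (x₃ * x₄) := by
  have hS := one_add_sq_ne_zero hq
  have hW := cyclotomic_ne_zero_horner hq
  have hF := fourth_add_one_ne_zero hq
  have h54 := H.r54 hq0 hq
  have h41 := H.r41 hq0 hq
  have h := mul_assoc x₅ x₄ x₁
  rw [h54, h41] at h
  simp only [mul_sub, sub_mul, mul_add, add_mul, mul_smul_comm, smul_mul_assoc, mul_assoc,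
    H.r31, H.r51, H.r53, h54, h41,
    mul_mul_of_mul_eq H.r31, mul_mul_of_mul_eq H.r51, mul_mul_of_mul_eq H.r53,
    mul_mul_of_mul_eq h54, mul_mul_of_mul_eq h41] at h
  linear_combination (norm := skip) -(q / (q ^ 4 + 1)) • h
  match_scalars <;> field_simp <;> ring

theorem r42 (H : RootVectorRelations q x₁ x₂ x₃ x₄ x₅ x₆) (hq0 : q ≠ 0)
    (hq : ∀ n : ℕ, 0 < n → q ^ n ≠ 1) :
    x₄ * x₂ = (q ^ 3)⁻¹ • (x₂ * x₄)
      - ((q ^ 2 - 1) ^ 2 / (q ^ 4 + q ^ 2 + 1)) • (x₃ * (x₃ * x₃)) := by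
  have hS := one_add_sq_ne_zero hq
  have hW := cyclotomic_ne_zero_horner hq
  have h43 := H.r43 hq0 hq
  have h41 := H.r41 hq0 hq
  have h32 := H.r32 hq0 hq
  have h := mul_assoc x₄ x₃ x₁
  rw [h43, H.r31] at h
  simp only [mul_sub, sub_mul, mul_add, add_mul, mul_smul_comm, smul_mul_assoc, mul_assoc,
    H.r31, h43, h41, h32,
    mul_mul_of_mul_eq H.r31, mul_mul_of_mul_eq h43, mul_mul_of_mul_eq h41,
    mul_mul_of_mul_eq h32] at h
  linear_combination (norm := skip) ((q ^ 4 + q ^ 2 + 1) / q ^ 3)⁻¹ • h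
  match_scalars <;> field_simp <;> ring

end RootVectorRelations

/-! ### Quantum tori -/

/-- The quantum torus on the group `G` with parameter `q` and bilinear form `B`: it has a basis
`X g`, `g ∈ G`, and `X g * X h = q ^ B g h • X (g + h)`. -/
def QuantumTorus {K : Type u} [Field K] {G : Type v} [AddCommGroup G] (_q : Kˣ)
    (_B : G →+ G →+ ℤ) : Type (max u v) := G →₀ K

namespace QuantumTorus

section Algebra

variable {K : Type u} [Field K] {G : Type v} [AddCommGroup G] {q : Kˣ} {B : G →+ G →+ ℤ}

instance : AddCommGroup (QuantumTorus q B) := inferInstanceAs (AddCommGroup (G →₀ K))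

instance : Module K (QuantumTorus q B) := inferInstanceAs (Module K (G →₀ K))

/-- The basis of the quantum torus by monomials. -/
def basis (q : Kˣ) (B : G →+ G →+ ℤ) : Module.Basis G K (QuantumTorus q B) :=
  Module.Basis.ofRepr (LinearEquiv.refl K (G →₀ K))

/-- The monomial with exponent `g`. -/
def X (q : Kˣ) (B : G →+ G →+ ℤ) (g : G) : QuantumTorus q B := basis q B g

/-- The multiplication of the quantum torus as a bilinear map. -/
def mulHom : QuantumTorus q B →ₗ[K] QuantumTorus q B →ₗ[K] QuantumTorus q B :=
  (basis q B).constr K fun g => (basis q B).constr K fun h => ((q ^ B g h : Kˣ) : K) • X q B (g + h)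

instance : Mul (QuantumTorus q B) := ⟨fun f g => mulHom f g⟩

instance : One (QuantumTorus q B) := ⟨X q B 0⟩

theorem mul_def (f g : QuantumTorus q B) : f * g = mulHom f g := rfl

theorem one_def : (1 : QuantumTorus q B) = X q B 0 := rfl

theorem X_mul_X (g h : G) : X q B g * X q B h = ((q ^ B g h : Kˣ) : K) • X q B (g + h) := by
  rw [mul_def, mulHom, X, Module.Basis.constr_basis, X, Module.Basis.constr_basis]

theorem span_range_X : Submodule.span K (Set.range (X q B)) = ⊤ := (basis q B).span_eq

theorem induction {p : QuantumTorus q B → Prop} (f : QuantumTorus q B) (zero : p 0)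
    (X : ∀ g, p (X q B g)) (add : ∀ f g, p f → p g → p (f + g))
    (smul : ∀ (c : K) f, p f → p (c • f)) : p f := by
  have hf : f ∈ Submodule.span K (Set.range (QuantumTorus.X q B)) := by
    rw [span_range_X]; trivial
  induction hf using Submodule.span_induction with
  | mem x hx => obtain ⟨g, rfl⟩ := hx; exact X g
  | zero => exact zero
  | add x y _ _ hx hy => exact add x y hx hy
  | smul c x _ hx => exact smul c x hx

theorem add_mul_aux (f g h : QuantumTorus q B) : (f + g) * h = f * h + g * h := by
  simp [mul_def]

theorem mul_add_aux (f g h : QuantumTorus q B) : f * (g + h) = f * g + f * h := by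
  simp [mul_def]

theorem smul_mul_aux (c : K) (f g : QuantumTorus q B) : (c • f) * g = c • (f * g) := by
  simp [mul_def]

theorem mul_smul_aux (c : K) (f g : QuantumTorus q B) : f * (c • g) = c • (f * g) := by
  simp [mul_def]

theorem zero_mul_aux (f : QuantumTorus q B) : 0 * f = 0 := by simp [mul_def]

theorem mul_zero_aux (f : QuantumTorus q B) : f * 0 = 0 := by simp [mul_def]

theorem mul_assoc_aux (f g h : QuantumTorus q B) : f * g * h = f * (g * h) := by
  induction f using induction with
  | zero => simp only [zero_mul_aux]
  | add f f' hf hf' => simp only [add_mul_aux, hf, hf']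
  | smul c f hf => simp only [smul_mul_aux, hf]
  | X a =>
  induction g using induction with
  | zero => simp only [zero_mul_aux, mul_zero_aux]
  | add f f' hf hf' => simp only [add_mul_aux, mul_add_aux, hf, hf']
  | smul c f hf => simp only [smul_mul_aux, mul_smul_aux, hf]
  | X b =>
  induction h using induction with
  | zero => simp only [mul_zero_aux]
  | add f f' hf hf' => simp only [mul_add_aux, hf, hf']
  | smul c f hf => simp only [mul_smul_aux, hf]
  | X c =>
  -- Both bracketings carry the exponent B(a,b) + B(a,c) + B(b,c): bilinearity gives the cocycle
  -- identity.
  simp only [X_mul_X, smul_mul_aux, mul_smul_aux, smul_smul, map_add, AddMonoidHom.add_apply,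
    zpow_add, Units.val_mul, add_assoc]
  congr 1
  ring

instance : Ring (QuantumTorus q B) where
  __ := (inferInstance : AddCommGroup (QuantumTorus q B))
  mul_assoc := mul_assoc_aux
  left_distrib := mul_add_aux
  right_distrib := add_mul_aux
  zero_mul := zero_mul_aux
  mul_zero := mul_zero_aux
  one_mul f := by
    induction f using induction with
    | zero => exact mul_zero_aux _
    | add f f' hf hf' => rw [mul_add_aux, hf, hf']
    | smul c f hf => rw [mul_smul_aux, hf]
    | X a => simp [one_def, X_mul_X]
  mul_one f := by
    induction f using induction with
    | zero => exact zero_mul_aux _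
    | add f f' hf hf' => rw [add_mul_aux, hf, hf']
    | smul c f hf => rw [smul_mul_aux, hf]
    | X a => simp [one_def, X_mul_X]

instance : Algebra K (QuantumTorus q B) := Algebra.ofModule smul_mul_aux mul_smul_aux

/-- The coefficient of a monomial. -/
def coeff (g : G) : QuantumTorus q B →ₗ[K] K := (basis q B).coord g

theorem coeff_X [DecidableEq G] (g h : G) : coeff g (X q B h) = if h = g then 1 else 0 := by
  classical
  rw [coeff, X, Module.Basis.coord_apply, Module.Basis.repr_self, Finsupp.single_apply]

theorem coeff_X_self (g : G) : coeff g (X q B g) = 1 := by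
  classical rw [coeff_X, if_pos rfl]

theorem coeff_X_of_ne {g h : G} (hgh : h ≠ g) : coeff g (X q B h) = 0 := by
  classical rw [coeff_X, if_neg hgh]

/-- The set of exponents of the monomials occurring in an element. -/
def supp (f : QuantumTorus q B) : Finset G := ((basis q B).repr f).support

theorem mem_supp {f : QuantumTorus q B} {g : G} : g ∈ supp f ↔ coeff g f ≠ 0 :=
  Finsupp.mem_support_iff

theorem supp_eq_empty {f : QuantumTorus q B} : supp f = ∅ ↔ f = 0 := by
  rw [supp, Finsupp.support_eq_empty, LinearEquiv.map_eq_zero_iff]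

theorem mem_span_X_iff {f : QuantumTorus q B} {s : Set G} :
    f ∈ Submodule.span K (X q B '' s) ↔ ∀ g, coeff g f ≠ 0 → g ∈ s := by
  have : X q B '' s = (basis q B) '' s := rfl
  rw [this, Module.Basis.mem_span_image]
  exact ⟨fun h g hg => h (mem_supp.2 hg), fun h g hg => h g (mem_supp.1 hg)⟩

theorem X_ne_zero (g : G) : X q B g ≠ 0 := (basis q B).ne_zero g

instance : Nontrivial (QuantumTorus q B) := ⟨⟨X q B 0, 0, X_ne_zero 0⟩⟩

theorem mul_mem_span_X {s t w : Set G} (h : ∀ a ∈ s, ∀ b ∈ t, a + b ∈ w) {f g : QuantumTorus q B}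
    (hf : f ∈ Submodule.span K (X q B '' s)) (hg : g ∈ Submodule.span K (X q B '' t)) :
    f * g ∈ Submodule.span K (X q B '' w) := by
  have h1 := Submodule.mul_mem_mul hf hg
  rw [Submodule.span_mul_span] at h1
  refine Submodule.span_le.2 ?_ h1
  rintro _ ⟨_, ⟨a, ha, rfl⟩, _, ⟨b, hb, rfl⟩, rfl⟩
  change X q B a * X q B b ∈ _
  rw [X_mul_X]
  exact Submodule.smul_mem _ _ (Submodule.subset_span ⟨_, h a ha b hb, rfl⟩)

theorem coeff_mul_X (f : QuantumTorus q B) (g h : G) :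
    coeff (g + h) (f * X q B h) = ((q ^ B g h : Kˣ) : K) * coeff g f := by
  induction f using induction with
  | zero => simp
  | add f f' hf hf' => simp [add_mul, hf, hf', mul_add]
  | smul c f hf => simp [hf]; ring
  | X a =>
    rw [X_mul_X]
    by_cases hag : a = g
    · subst hag; simp [coeff_X_self]
    · simp [coeff_X_of_ne hag, coeff_X_of_ne (fun h' => hag (add_right_cancel h'))]

theorem coeff_X_mul (f : QuantumTorus q B) (g h : G) :
    coeff (g + h) (X q B h * f) = ((q ^ B h g : Kˣ) : K) * coeff g f := by
  induction f using induction with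
  | zero => simp
  | add f f' hf hf' => simp [mul_add, hf, hf']
  | smul c f hf => simp [hf]; ring
  | X a =>
    rw [X_mul_X, add_comm h a]
    by_cases hag : a = g
    · subst hag; simp [coeff_X_self]
    · simp [coeff_X_of_ne hag, coeff_X_of_ne (fun h' => hag (add_right_cancel h'))]

/-- If `q` is not a root of unity, an element commuting with a monomial `X h` is supported on the
exponents orthogonal to `h`. -/
theorem form_eq_of_commute (hq : ∀ n : ℕ, 0 < n → (q : K) ^ n ≠ 1) {f : QuantumTorus q B} {h : G}
    (hf : Commute f (X q B h)) {g : G} (hg : coeff g f ≠ 0) : B g h = B h g := by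
  have h1 := coeff_mul_X f g h
  rw [hf.eq, coeff_X_mul] at h1
  have h2 := mul_right_cancel₀ hg h1
  have h3 : q ^ (B g h - B h g) = 1 := by
    rw [zpow_sub, mul_inv_eq_one]
    exact Units.ext h2.symm
  by_contra hne
  have h4 : q ^ (B g h - B h g).natAbs = 1 := by
    rcases Int.natAbs_eq (B g h - B h g) with h5 | h5
    · rw [h5, zpow_natCast] at h3; exact h3
    · rw [h5, zpow_neg, inv_eq_one, zpow_natCast] at h3; exact h3
  refine hq _ (Int.natAbs_pos.2 (sub_ne_zero.2 hne)) ?_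
  rw [← Units.val_pow_eq_pow_val, h4, Units.val_one]

end Algebra

/-! ### Leading exponents for a linear order on the group of exponents. -/

section Lead

variable {K : Type u} [Field K] {G : Type v} [AddCommGroup G] [LinearOrder G]
  {q : Kˣ} {B : G →+ G →+ ℤ}

/-- The element `f` has leading exponent `g`. -/
structure HasLead (f : QuantumTorus q B) (g : G) : Prop where
  coeff_ne_zero : coeff g f ≠ 0
  le : ∀ h, coeff h f ≠ 0 → h ≤ g

theorem HasLead.ne_zero {f : QuantumTorus q B} {g : G} (h : HasLead f g) : f ≠ 0 := by
  rintro rfl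
  exact h.coeff_ne_zero (map_zero _)

theorem exists_hasLead {f : QuantumTorus q B} (hf : f ≠ 0) : ∃ g, HasLead f g := by
  have hs : (supp f).Nonempty := Finset.nonempty_iff_ne_empty.2 (mt supp_eq_empty.1 hf)
  obtain ⟨g, hg, hmax⟩ := Finset.exists_max_image (supp f) id hs
  exact ⟨g, mem_supp.1 hg, fun h hh => hmax h (mem_supp.2 hh)⟩

theorem HasLead.sub_mem {f : QuantumTorus q B} {g : G} (h : HasLead f g) :
    f - coeff g f • X q B g ∈ Submodule.span K (X q B '' Set.Iio g) := by
  rw [mem_span_X_iff]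
  intro a ha
  rw [map_sub, map_smul] at ha
  by_cases hag : a = g
  · subst hag; simp [coeff_X_self] at ha
  · rw [coeff_X_of_ne (Ne.symm hag), smul_zero, sub_zero] at ha
    exact lt_of_le_of_ne (h.le a ha) hag

theorem hasLead_smul_X_add {c : K} (hc : c ≠ 0) {g : G} {r : QuantumTorus q B}
    (hr : r ∈ Submodule.span K (X q B '' Set.Iio g)) : HasLead (c • X q B g + r) g := by
  rw [mem_span_X_iff] at hr
  constructor
  · have : coeff g r = 0 := by
      by_contra h
      exact lt_irrefl _ (hr g h)
    simpa [coeff_X_self, this] using hc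
  · intro h hh
    by_cases hgh : g = h
    · exact hgh.ge
    · rw [map_add, map_smul, coeff_X_of_ne hgh, smul_zero, zero_add] at hh
      exact (hr h hh).le

/-- A nontrivial linear combination of elements with distinct leading exponents has a leading
exponent among them. -/
theorem exists_hasLead_linearCombination {ι : Type*} {m : ι → QuantumTorus q B} {d : ι → G}
    (hd : Function.Injective d) (hm : ∀ i, HasLead (m i) (d i)) {c : ι →₀ K} (hc : c ≠ 0) :
    ∃ i, HasLead (Finsupp.linearCombination K m c) (d i) := by
  classical
  -- The index of the support with the largest leading exponent; since the exponents are distinct,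
  -- no other term can cancel its leading term.
  obtain ⟨i, hi, hmax⟩ := Finset.exists_max_image c.support d (Finsupp.support_nonempty_iff.2 hc)
  refine ⟨i, ?_⟩
  have hlt : ∀ j ∈ c.support, j ≠ i → d j < d i := fun j hj hji =>
    lt_of_le_of_ne (hmax j hj) (fun h => hji (hd h))
  rw [Finsupp.linearCombination_apply, Finsupp.sum, ← Finset.add_sum_erase _ _ hi]
  have hsplit := (hm i).sub_mem
  obtain ⟨r, hr⟩ : ∃ r, r = m i - coeff (d i) (m i) • X q B (d i) := ⟨_, rfl⟩
  have hmi : m i = coeff (d i) (m i) • X q B (d i) + r := by rw [hr]; abel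
  rw [hmi, smul_add, smul_smul, add_assoc]
  refine hasLead_smul_X_add (mul_ne_zero (Finsupp.mem_support_iff.1 hi) (hm i).coeff_ne_zero)
    (add_mem (Submodule.smul_mem _ _ (hr ▸ hsplit)) (sum_mem fun j hj => Submodule.smul_mem _ _ ?_))
  rw [Finset.mem_erase] at hj
  rw [mem_span_X_iff]
  exact fun a ha => lt_of_le_of_lt ((hm j).le a ha) (hlt j hj.2 hj.1)

theorem hasLead_one : HasLead (1 : QuantumTorus q B) 0 := by
  rw [one_def, ← one_smul K (X q B 0), ← add_zero ((1 : K) • X q B 0)]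
  exact hasLead_smul_X_add one_ne_zero (zero_mem _)

variable [IsOrderedAddMonoid G]

/-- The product of the two leading monomials is a nonzero multiple of X (g + g'), and translation
invariance of the order puts the three other products strictly below it. -/
theorem HasLead.mul {f f' : QuantumTorus q B} {g g' : G} (h : HasLead f g) (h' : HasLead f' g') :
    HasLead (f * f') (g + g') := by
  obtain ⟨r, hr⟩ : ∃ r, r = f - coeff g f • X q B g := ⟨_, rfl⟩
  obtain ⟨r', hr'⟩ : ∃ r, r = f' - coeff g' f' • X q B g' := ⟨_, rfl⟩
  have hmem := hr ▸ h.sub_mem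
  have hmem' := hr' ▸ h'.sub_mem
  have hX : ∀ a : G, X q B a ∈ Submodule.span K (X q B '' {a}) := fun a =>
    Submodule.subset_span ⟨a, rfl, rfl⟩
  have hfe : f = coeff g f • X q B g + r := by rw [hr]; abel
  have hfe' : f' = coeff g' f' • X q B g' + r' := by rw [hr']; abel
  have key : f * f' = (coeff g f * coeff g' f' * ((q ^ B g g' : Kˣ) : K)) • X q B (g + g')
      + (coeff g f • (X q B g * r') + coeff g' f' • (r * X q B g') + r * r') := by
    conv_lhs => rw [hfe, hfe']
    simp only [add_mul, mul_add, smul_mul_assoc, mul_smul_comm, X_mul_X, smul_smul]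
    module
  rw [key]
  refine hasLead_smul_X_add (mul_ne_zero (mul_ne_zero h.coeff_ne_zero h'.coeff_ne_zero)
    (Units.ne_zero _))
    (add_mem (add_mem (Submodule.smul_mem _ _ ?_) (Submodule.smul_mem _ _ ?_)) ?_)
  · refine mul_mem_span_X ?_ (hX g) hmem'
    rintro _ rfl b hb
    exact add_lt_add_right hb _
  · refine mul_mem_span_X ?_ hmem (hX g')
    rintro b hb _ rfl
    exact add_lt_add_left hb _
  · refine mul_mem_span_X ?_ hmem hmem'
    intro a ha b hb
    exact add_lt_add ha hb

theorem HasLead.pow {f : QuantumTorus q B} {g : G} (h : HasLead f g) (n : ℕ) :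
    HasLead (f ^ n) (n • g) := by
  induction n with
  | zero => simpa using hasLead_one
  | succ n ih => rw [pow_succ, succ_nsmul]; exact ih.mul h

instance : NoZeroDivisors (QuantumTorus q B) where
  eq_zero_or_eq_zero_of_mul_eq_zero {f g} h := by
    by_contra! hne
    obtain ⟨a, ha⟩ := exists_hasLead hne.1
    obtain ⟨b, hb⟩ := exists_hasLead hne.2
    exact (ha.mul hb).ne_zero h

end Lead

end QuantumTorus

open QuantumTorus

/-! ### Closed forms of the scalars -/

section Scalars

variable {K : Type u} [Field K] {q : K}

theorem one_sub_inv_six (hq0 : q ≠ 0) :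
    1 - (q ^ 6)⁻¹ = (q ^ 2 - 1) * (q ^ 4 + q ^ 2 + 1) / q ^ 6 := by
  field_simp
  ring

theorem one_sub_inv_sq (hq0 : q ≠ 0) : 1 - (q ^ 2)⁻¹ = (q ^ 2 - 1) / q ^ 2 := by
  field_simp

theorem inv_sq_sub_one (hq0 : q ≠ 0) : (q ^ 2)⁻¹ - 1 = -((q ^ 2 - 1) / q ^ 2) := by
  rw [← one_sub_inv_sq hq0]
  ring

theorem cA_eq (hq0 : q ≠ 0) :
    cA q = -((q ^ 4 + q ^ 2 + 1) / (q ^ 2 - 1)) := by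
  rw [cA, inv_sq_sub_one hq0]
  field_simp

theorem cB_eq (hq0 : q ≠ 0) (hq : ∀ n : ℕ, 0 < n → q ^ n ≠ 1) :
    cB q = -(q ^ 9 * (q ^ 2 - 1) / (q ^ 4 + q ^ 2 + 1) ^ 2) := by
  have hW := cyclotomic_ne_zero_horner hq
  have hD := sq_sub_one_ne_zero hq
  rw [cB, one_sub_inv_six hq0]
  field_simp
  ring

theorem cE_eq (hq : ∀ n : ℕ, 0 < n → q ^ n ≠ 1) :
    cE q = -(q ^ 3 * (q ^ 4 + q ^ 2 + 1) / (q ^ 2 - 1) ^ 2) := by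
  have hW := cyclotomic_ne_zero_horner hq
  have hD := sq_sub_one_ne_zero hq
  rw [cE, show q ^ 4 - 2 * q ^ 2 + 1 = (q ^ 2 - 1) ^ 2 by ring]
  field_simp

theorem cF_eq (hq0 : q ≠ 0) (hq : ∀ n : ℕ, 0 < n → q ^ n ≠ 1) :
    cF q = -q ^ 2 := by
  have hW := cyclotomic_ne_zero_horner hq
  have hD := sq_sub_one_ne_zero hq
  rw [cF, one_sub_inv_sq hq0]
  field_simp
  ring

theorem cG_eq (hq0 : q ≠ 0) (hq : ∀ n : ℕ, 0 < n → q ^ n ≠ 1) :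
    cG q = q * (q ^ 4 + q ^ 2 + 1) / (q ^ 2 - 1) ^ 2 := by
  have hW := cyclotomic_ne_zero_horner hq
  have hD := sq_sub_one_ne_zero hq
  rw [cG, one_sub_inv_sq hq0]
  field_simp

theorem cH_eq (hq0 : q ≠ 0) :
    cH q = -(q * (q ^ 2 + 1) / (q ^ 2 - 1)) := by
  rw [cH, inv_sq_sub_one hq0]
  field_simp

theorem cR_eq (hq0 : q ≠ 0) (hq : ∀ n : ℕ, 0 < n → q ^ n ≠ 1) :
    cR q = -(q ^ 6 / ((q ^ 2 - 1) * (q ^ 4 + q ^ 2 + 1))) := by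
  have hW := cyclotomic_ne_zero_horner hq
  have hD := sq_sub_one_ne_zero hq
  rw [cR, one_sub_inv_six hq0]
  field_simp

theorem cS_eq (hq0 : q ≠ 0) (hq : ∀ n : ℕ, 0 < n → q ^ n ≠ 1) :
    cS q = -(q ^ 6 / (q ^ 4 + q ^ 2 + 1)) := by
  have hW := cyclotomic_ne_zero_horner hq
  have hD := sq_sub_one_ne_zero hq
  rw [cS, one_sub_inv_six hq0]
  field_simp
  ring

theorem cT_eq (hq0 : q ≠ 0) (hq : ∀ n : ℕ, 0 < n → q ^ n ≠ 1) :
    cT q = -(q ^ 5 / (q ^ 4 + q ^ 2 + 1)) := by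
  have hW := cyclotomic_ne_zero_horner hq
  have hD := sq_sub_one_ne_zero hq
  rw [cT, one_sub_inv_six hq0]
  field_simp
  ring

theorem cU_eq (hq0 : q ≠ 0) (hq : ∀ n : ℕ, 0 < n → q ^ n ≠ 1) :
    cU q = q ^ 3 * (q ^ 4 + q ^ 2 - 1) / ((q ^ 2 - 1) * (q ^ 4 + q ^ 2 + 1)) := by
  have hW := cyclotomic_ne_zero_horner hq
  have hD := sq_sub_one_ne_zero hq
  rw [cU, one_sub_inv_six hq0]
  field_simp

theorem cD'_eq : cD' q = q ^ 12 / ((q ^ 2 - 1) * (q ^ 4 + q ^ 2 + 1)) := by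
  rw [cD']
  congr 1
  ring

end Scalars

/-! ### The quantum torus of the deleting derivations algorithm -/

/-- Exponents of Laurent monomials in `T₁, …, T₆`, ordered lexicographically. -/
abbrev Exponent : Type := Lex (Fin 6 → ℤ)

/-- The exponent with given coordinates. -/
def expo (a b c d e f : ℤ) : Exponent := toLex ![a, b, c, d, e, f]

/-- The exponents of `q` in the product of two ordered monomials in `T₁, …, T₆`. -/
def form : Exponent →+ Exponent →+ ℤ :=
  AddMonoidHom.mk' (fun x => AddMonoidHom.mk' (fun y =>
    -3 * ofLex x 1 * ofLex y 0 - ofLex x 2 * ofLex y 0 - 3 * ofLex x 2 * ofLex y 1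
      - 3 * ofLex x 3 * ofLex y 1 - 3 * ofLex x 3 * ofLex y 2
      + ofLex x 4 * ofLex y 0 - ofLex x 4 * ofLex y 2 - 3 * ofLex x 4 * ofLex y 3
      + 3 * ofLex x 5 * ofLex y 0 + 3 * ofLex x 5 * ofLex y 1 - 3 * ofLex x 5 * ofLex y 3
      - 3 * ofLex x 5 * ofLex y 4)
    (fun y z => by simp only [ofLex_add, Pi.add_apply]; ring))
    (fun x z => by
      ext y
      simp only [AddMonoidHom.mk'_apply, AddMonoidHom.add_apply, ofLex_add, Pi.add_apply]
      ring)

theorem expo_add (a b c d e f a' b' c' d' e' f' : ℤ) :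
    expo a b c d e f + expo a' b' c' d' e' f' =
      expo (a + a') (b + b') (c + c') (d + d') (e + e') (f + f') := by
  rw [expo, expo, expo, ← toLex_add]
  simp

theorem form_expo (a b c d e f a' b' c' d' e' f' : ℤ) :
    form (expo a b c d e f) (expo a' b' c' d' e' f') =
      -3 * b * a' - c * a' - 3 * c * b' - 3 * d * b' - 3 * d * c' + e * a' - e * c' - 3 * e * d'
        + 3 * f * a' + 3 * f * b' - 3 * f * d' - 3 * f * e' := rfl

section Torus

variable {K : Type u} [Field K] {q : K}

/-- The quantum torus generated by `T₁, …, T₆` and their inverses. -/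
abbrev Torus (hq0 : q ≠ 0) : Type u := QuantumTorus (Units.mk0 q hq0) form

/-- The ordered Laurent monomial `T₁ ^ a * T₂ ^ b * ⋯ * T₆ ^ f`. -/
def mono (hq0 : q ≠ 0) (a b c d e f : ℤ) : Torus hq0 := X _ _ (expo a b c d e f)

theorem mono_mul (hq0 : q ≠ 0) (a b c d e f a' b' c' d' e' f' : ℤ) :
    mono hq0 a b c d e f * mono hq0 a' b' c' d' e' f' =
      q ^ (-3 * b * a' - c * a' - 3 * c * b' - 3 * d * b' - 3 * d * c' + e * a' - e * c'
        - 3 * e * d' + 3 * f * a' + 3 * f * b' - 3 * f * d' - 3 * f * e') •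
      mono hq0 (a + a') (b + b') (c + c') (d + d') (e + e') (f + f') := by
  rw [mono, mono, X_mul_X, form_expo, expo_add, Units.val_zpow_eq_zpow_val, Units.val_mk0, mono]

theorem mono_zero (hq0 : q ≠ 0) : mono hq0 0 0 0 0 0 0 = 1 := by
  rw [mono, one_def]
  congr 1
  rw [expo]
  refine congrArg toLex (funext fun i => ?_)
  fin_cases i <;> rfl

/-- The image of `E₁` in the quantum torus. -/
def e1 (hq0 : q ≠ 0) : Torus hq0 :=
  mono hq0 1 0 0 0 0 0 + ((q ^ 4 + q ^ 2 + 1) / (q ^ 2 - 1)) • mono hq0 0 1 (-1) 0 0 0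
    + (q ^ 6 / (q ^ 4 + q ^ 2 + 1)) • mono hq0 0 0 2 (-1) 0 0
    + (q * (q ^ 2 + 1) / (q ^ 2 - 1)) • mono hq0 0 0 1 0 (-1) 0
    + (q ^ 3 * (q ^ 4 + q ^ 2 + 1) / (q ^ 2 - 1) ^ 2) • mono hq0 0 0 0 1 (-2) 0
    + (q ^ 6 / ((q ^ 2 - 1) * (q ^ 4 + q ^ 2 + 1))) • mono hq0 0 0 0 0 1 (-1)

/-- The image of `E₂` in the quantum torus. -/
def e2 (hq0 : q ≠ 0) : Torus hq0 :=
  mono hq0 0 1 0 0 0 0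
    + (q ^ 9 * (q ^ 2 - 1) / (q ^ 4 + q ^ 2 + 1) ^ 2) • mono hq0 0 0 3 (-1) 0 0
    + q ^ 2 • mono hq0 0 0 2 0 (-1) 0
    + (q ^ 2 * (q ^ 4 + q ^ 2 + 1) / (q ^ 2 - 1)) • mono hq0 0 0 1 1 (-2) 0
    + (q ^ 9 * (q ^ 4 + q ^ 2 + 1) / (q ^ 2 - 1) ^ 2) • mono hq0 0 0 0 2 (-3) 0
    + (q ^ 5 / (q ^ 4 + q ^ 2 + 1)) • mono hq0 0 0 1 0 1 (-1)
    + (q ^ 3 * (q ^ 6 + 1) / ((q ^ 2 - 1) * (q ^ 4 + q ^ 2 + 1))) • mono hq0 0 0 0 1 0 (-1)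
    + (q ^ 18 / (q ^ 4 + q ^ 2 + 1) ^ 3) • mono hq0 0 0 0 0 3 (-2)

/-- The image of `E₃` in the quantum torus. -/
def e3 (hq0 : q ≠ 0) : Torus hq0 :=
  mono hq0 0 0 1 0 0 0 + ((q ^ 4 + q ^ 2 + 1) / (q ^ 2 - 1)) • mono hq0 0 0 0 1 (-1) 0
    + (q ^ 6 / (q ^ 4 + q ^ 2 + 1)) • mono hq0 0 0 0 0 2 (-1)

/-- The image of `E₄` in the quantum torus. -/
def e4 (hq0 : q ≠ 0) : Torus hq0 :=
  mono hq0 0 0 0 1 0 0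
    + (q ^ 9 * (q ^ 2 - 1) / (q ^ 4 + q ^ 2 + 1) ^ 2) • mono hq0 0 0 0 0 3 (-1)

/-- The image of `E₅` in the quantum torus. -/
def e5 (hq0 : q ≠ 0) : Torus hq0 := mono hq0 0 0 0 0 1 0

/-- The image of `E₆` in the quantum torus. -/
def e6 (hq0 : q ≠ 0) : Torus hq0 := mono hq0 0 0 0 0 0 1

/-- The coefficients of the eᵢ come from solving the steps of the algorithm backwards for E₁, …, E₆.
This identity and the next five are all that a homomorphism out of U_q^+(G₂) requires. -/
theorem torus_r61 (hq0 : q ≠ 0) (hq : ∀ n : ℕ, 0 < n → q ^ n ≠ 1) :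
    e6 hq0 * e1 hq0 = q ^ 3 • (e1 hq0 * e6 hq0) - q ^ 3 • e5 hq0 := by
  have hW := cyclotomic_ne_zero_horner hq
  have hD := sq_sub_one_ne_zero hq
  simp only [e1, e5, e6, add_mul, mul_add, smul_mul_assoc, mul_smul_comm, mono_mul]
  norm_num [zpow_neg]
  match_scalars <;> field_simp <;> ring

theorem torus_r51 (hq0 : q ≠ 0) (hq : ∀ n : ℕ, 0 < n → q ^ n ≠ 1) :
    e5 hq0 * e1 hq0 = q • (e1 hq0 * e5 hq0) - (1 + q ^ 2) • e3 hq0 := by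
  have hW := cyclotomic_ne_zero_horner hq
  have hD := sq_sub_one_ne_zero hq
  simp only [e1, e3, e5, add_mul, mul_add, smul_mul_assoc, mul_smul_comm, mono_mul]
  norm_num [zpow_neg]
  match_scalars <;> field_simp <;> ring

theorem torus_r31 (hq0 : q ≠ 0) (hq : ∀ n : ℕ, 0 < n → q ^ n ≠ 1) :
    e3 hq0 * e1 hq0 = q⁻¹ • (e1 hq0 * e3 hq0) - ((q ^ 4 + q ^ 2 + 1) / q ^ 3) • e2 hq0 := by
  have hW := cyclotomic_ne_zero_horner hq
  have hD := sq_sub_one_ne_zero hq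
  simp only [e1, e2, e3, add_mul, mul_add, smul_mul_assoc, mul_smul_comm, mono_mul]
  norm_num [zpow_neg]
  match_scalars <;> field_simp <;> ring

theorem torus_r53 (hq0 : q ≠ 0) (hq : ∀ n : ℕ, 0 < n → q ^ n ≠ 1) :
    e5 hq0 * e3 hq0 = q⁻¹ • (e3 hq0 * e5 hq0) - ((q ^ 4 + q ^ 2 + 1) / q ^ 3) • e4 hq0 := by
  have hW := cyclotomic_ne_zero_horner hq
  have hD := sq_sub_one_ne_zero hq
  simp only [e3, e4, e5, add_mul, mul_add, smul_mul_assoc, mul_smul_comm, mono_mul]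
  norm_num [zpow_neg]
  match_scalars <;> field_simp <;> ring

theorem torus_r65 (hq0 : q ≠ 0) : e6 hq0 * e5 hq0 = (q ^ 3)⁻¹ • (e5 hq0 * e6 hq0) := by
  simp only [e5, e6, mono_mul]
  norm_num [zpow_neg]

theorem torus_r21 (hq0 : q ≠ 0) (hq : ∀ n : ℕ, 0 < n → q ^ n ≠ 1) :
    e2 hq0 * e1 hq0 = (q ^ 3)⁻¹ • (e1 hq0 * e2 hq0) := by
  have hW := cyclotomic_ne_zero_horner hq
  have hD := sq_sub_one_ne_zero hq
  simp only [e1, e2, add_mul, mul_add, smul_mul_assoc, mul_smul_comm, mono_mul]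
  norm_num [zpow_neg]
  match_scalars <;> field_simp <;> ring

theorem torus_rootVectorRelations (hq0 : q ≠ 0) (hq : ∀ n : ℕ, 0 < n → q ^ n ≠ 1) :
    RootVectorRelations q (e1 hq0) (e2 hq0) (e3 hq0) (e4 hq0) (e5 hq0) (e6 hq0) where
  r61 := torus_r61 hq0 hq
  r51 := torus_r51 hq0 hq
  r31 := torus_r31 hq0 hq
  r53 := torus_r53 hq0 hq
  r65 := torus_r65 hq0
  r21 := torus_r21 hq0 hq

/-- The coefficients a and a' are those for which every monomial but T₁T₃T₅ cancels. -/
theorem torus_omega1 (hq0 : q ≠ 0) (hq : ∀ n : ℕ, 0 < n → q ^ n ≠ 1) :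
    e1 hq0 * e3 hq0 * e5 hq0 + cA q • (e1 hq0 * e4 hq0) + cA q • (e2 hq0 * e5 hq0)
      + cA' q • e3 hq0 ^ 2 = mono hq0 1 0 1 0 1 0 := by
  have hW := cyclotomic_ne_zero_horner hq
  have hD := sq_sub_one_ne_zero hq
  simp only [cA_eq hq0, cA', e1, e2, e3, e4, e5, pow_two (_ : Torus hq0), add_mul, mul_add,
    smul_mul_assoc, mul_smul_comm, mono_mul]
  norm_num [zpow_neg]
  match_scalars <;> field_simp <;> ring

theorem torus_omega2 (hq0 : q ≠ 0) (hq : ∀ n : ℕ, 0 < n → q ^ n ≠ 1) :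
    e2 hq0 * e4 hq0 * e6 hq0 + cB q • (e2 hq0 * e5 hq0 ^ 3) + cB q • (e3 hq0 ^ 3 * e6 hq0)
      + cB' q • (e3 hq0 ^ 2 * e5 hq0 ^ 2) + cC' q • (e3 hq0 * e4 hq0 * e5 hq0)
      + cD' q • e4 hq0 ^ 2 = mono hq0 0 1 0 1 0 1 := by
  have hW := cyclotomic_ne_zero_horner hq
  have hD := sq_sub_one_ne_zero hq
  simp only [cB_eq hq0 hq, cB', cC', cD'_eq, e2, e3, e4, e5, e6, pow_succ (_ : Torus hq0),
    pow_zero, one_mul, add_mul, mul_add, smul_mul_assoc, mul_smul_comm, mono_mul]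
  norm_num [zpow_neg]
  match_scalars <;> field_simp <;> ring

end Torus

/-! ### Root vectors of `U_q^+(G_2)` -/

section Embedding

variable {K : Type u} [Field K] {q : K}

/-- Four of the relations restate the definitions of E₅, E₃, E₂, E₄; the short and long Serre
relations supply `r21` and `r65`, after division by the nonzero scalar of `serre_short_eq` in the
first case. -/
theorem rootVectorRelations (hq0 : q ≠ 0) (hq : ∀ n : ℕ, 0 < n → q ^ n ≠ 1) :
    RootVectorRelations q (E1 q) (E2 q) (E3 q) (E4 q) (E5 q) (E6 q) := by
  have hS := one_add_sq_ne_zero hq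
  have hW := cyclotomic_ne_zero hq
  have hk : (q ^ 4 + q ^ 2 + 1) / q ^ 3 ≠ 0 := div_ne_zero hW (pow_ne_zero 3 hq0)
  have hq3 : q ^ 3 ≠ 0 := pow_ne_zero 3 hq0
  have hs1 := RingQuot.mkAlgHom_rel K (SerreRel.s1 (q := q))
  have hs2 := RingQuot.mkAlgHom_rel K (SerreRel.s2 (q := q))
  simp only [map_add, map_sub, map_mul, map_pow, map_smul, map_zero] at hs1 hs2
  change E1 q ^ 4 * E6 q - qBinom q 4 1 • (E1 q ^ 3 * E6 q * E1 q)
    + qBinom q 4 2 • (E1 q ^ 2 * E6 q * E1 q ^ 2) - qBinom q 4 1 • (E1 q * E6 q * E1 q ^ 3)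
    + E6 q * E1 q ^ 4 = 0 at hs1
  change E6 q ^ 2 * E1 q - qBinom (q ^ 3) 2 1 • (E6 q * E1 q * E6 q) + E1 q * E6 q ^ 2 = 0 at hs2
  rw [serre_short_eq (x₅ := E5 q) (x₃ := E3 q) (x₂ := E2 q) hq0 hq rfl rfl rfl,
    smul_eq_zero_iff_right (mul_ne_zero hS hW), sub_eq_zero] at hs1
  rw [serre_long_eq (x₅ := E5 q) hq0 hq rfl, sub_eq_zero] at hs2
  refine ⟨?_, ?_, ?_, ?_, ?_, hs1.symm⟩
  · rw [E5, smul_sub, smul_inv_smul₀ hq3]; abel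
  · rw [E3, smul_inv_smul₀ hS]; abel
  · rw [E2, k_eq hq0, smul_inv_smul₀ hk]; abel
  · rw [E4, k_eq hq0, smul_inv_smul₀ hk]; abel
  · rw [hs2, inv_smul_smul₀ hq3]

/-- The values of the embedding into the quantum torus on the generators. -/
def torusGen (hq0 : q ≠ 0) : SimpleRoot → Torus hq0
  | SimpleRoot.α => e1 hq0
  | SimpleRoot.β => e6 hq0

namespace RootVectorRelations

variable {R : Type v} [Ring R] [Algebra K R] {x₁ x₂ x₃ x₄ x₅ x₆ : R}

theorem x5_eq (H : RootVectorRelations q x₁ x₂ x₃ x₄ x₅ x₆) (hq0 : q ≠ 0) :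
    x₅ = x₁ * x₆ - (q ^ 3)⁻¹ • (x₆ * x₁) := by
  rw [H.r61, smul_sub, inv_smul_smul₀ (pow_ne_zero 3 hq0), inv_smul_smul₀ (pow_ne_zero 3 hq0)]
  abel

theorem x3_eq (H : RootVectorRelations q x₁ x₂ x₃ x₄ x₅ x₆)
    (hq : ∀ n : ℕ, 0 < n → q ^ n ≠ 1) :
    x₃ = (1 + q ^ 2)⁻¹ • (q • (x₁ * x₅) - x₅ * x₁) := by
  rw [H.r51, sub_sub_cancel, inv_smul_smul₀ (one_add_sq_ne_zero hq)]

theorem x2_eq (H : RootVectorRelations q x₁ x₂ x₃ x₄ x₅ x₆) (hq0 : q ≠ 0)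
    (hq : ∀ n : ℕ, 0 < n → q ^ n ≠ 1) :
    x₂ = (q + q⁻¹ + (q ^ 3)⁻¹)⁻¹ • (q⁻¹ • (x₁ * x₃) - x₃ * x₁) := by
  rw [H.r31, sub_sub_cancel, k_eq hq0,
    inv_smul_smul₀ (div_ne_zero (cyclotomic_ne_zero hq) (pow_ne_zero 3 hq0))]

theorem x4_eq (H : RootVectorRelations q x₁ x₂ x₃ x₄ x₅ x₆) (hq0 : q ≠ 0)
    (hq : ∀ n : ℕ, 0 < n → q ^ n ≠ 1) :
    x₄ = (q + q⁻¹ + (q ^ 3)⁻¹)⁻¹ • (q⁻¹ • (x₃ * x₅) - x₅ * x₃) := by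
  rw [H.r53, sub_sub_cancel, k_eq hq0,
    inv_smul_smul₀ (div_ne_zero (cyclotomic_ne_zero hq) (pow_ne_zero 3 hq0))]

end RootVectorRelations

/-- The embedding of `U_q^+(G_2)` into the quantum torus. -/
def toTorus (hq0 : q ≠ 0) (hq : ∀ n : ℕ, 0 < n → q ^ n ≠ 1) : UqPlus q →ₐ[K] Torus hq0 :=
  RingQuot.liftAlgHom K ⟨FreeAlgebra.lift K (torusGen hq0), by
    have H := torus_rootVectorRelations hq0 hq
    have hα : FreeAlgebra.lift K (torusGen hq0) (freeα K) = e1 hq0 := FreeAlgebra.lift_ι_apply _ _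
    have hβ : FreeAlgebra.lift K (torusGen hq0) (freeβ K) = e6 hq0 := FreeAlgebra.lift_ι_apply _ _
    -- The relators are scalar multiples of the q-commutators that `r21` and `r65` make vanish.
    rintro _ _ (_ | _)
    · simp only [map_add, map_sub, map_mul, map_pow, map_smul, map_zero, hα, hβ]
      rw [serre_short_eq hq0 hq (H.x5_eq hq0) (H.x3_eq hq) (H.x2_eq hq0 hq), H.r21, sub_self,
        smul_zero]
    · simp only [map_add, map_sub, map_mul, map_pow, map_smul, map_zero, hα, hβ]
      rw [serre_long_eq hq0 hq (H.x5_eq hq0), H.r65, smul_inv_smul₀ (pow_ne_zero 3 hq0),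
        sub_self]⟩

variable (hq0 : q ≠ 0) (hq : ∀ n : ℕ, 0 < n → q ^ n ≠ 1)

theorem toTorus_E1 : toTorus hq0 hq (E1 q) = e1 hq0 := by
  rw [toTorus, E1, RingQuot.liftAlgHom_mkAlgHom_apply]
  exact FreeAlgebra.lift_ι_apply _ _

theorem toTorus_E6 : toTorus hq0 hq (E6 q) = e6 hq0 := by
  rw [toTorus, E6, RingQuot.liftAlgHom_mkAlgHom_apply]
  exact FreeAlgebra.lift_ι_apply _ _

theorem toTorus_E5 : toTorus hq0 hq (E5 q) = e5 hq0 := by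
  rw [(torus_rootVectorRelations hq0 hq).x5_eq hq0, E5]
  simp only [map_sub, map_mul, map_smul, toTorus_E1, toTorus_E6]

theorem toTorus_E3 : toTorus hq0 hq (E3 q) = e3 hq0 := by
  rw [(torus_rootVectorRelations hq0 hq).x3_eq hq, E3]
  simp only [map_sub, map_mul, map_smul, toTorus_E1, toTorus_E5]

theorem toTorus_E2 : toTorus hq0 hq (E2 q) = e2 hq0 := by
  rw [(torus_rootVectorRelations hq0 hq).x2_eq hq0 hq, E2]
  simp only [map_sub, map_mul, map_smul, toTorus_E1, toTorus_E3]

theorem toTorus_E4 : toTorus hq0 hq (E4 q) = e4 hq0 := by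
  rw [(torus_rootVectorRelations hq0 hq).x4_eq hq0 hq, E4]
  simp only [map_sub, map_mul, map_smul, toTorus_E3, toTorus_E5]

theorem toTorus_Omega1 : toTorus hq0 hq (Omega1 q) = mono hq0 1 0 1 0 1 0 := by
  rw [← torus_omega1 hq0 hq, Omega1]
  simp only [map_add, map_mul, map_pow, map_smul, toTorus_E1, toTorus_E2, toTorus_E3, toTorus_E4,
    toTorus_E5]

theorem toTorus_Omega2 : toTorus hq0 hq (Omega2 q) = mono hq0 0 1 0 1 0 1 := by
  rw [← torus_omega2 hq0 hq, Omega2]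
  simp only [map_add, map_mul, map_pow, map_smul, toTorus_E2, toTorus_E3, toTorus_E4, toTorus_E5,
    toTorus_E6]

end Embedding

/-! ### Spanning by ordered monomials -/

section Spanning

variable {K : Type u} [Field K] {R : Type v} [Ring R] [Algebra K R]

/-- The sum of the spaces `x ^ n * B`. -/
def powSpan (x : R) (B : Subalgebra K R) : Submodule K R :=
  Submodule.span K {y | ∃ n : ℕ, ∃ b ∈ B, y = x ^ n * b}

theorem pow_mul_mem_powSpan {x : R} {B : Subalgebra K R} (n : ℕ) {b : R} (hb : b ∈ B) :
    x ^ n * b ∈ powSpan x B :=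
  Submodule.subset_span ⟨n, b, hb, rfl⟩

/-- If `g x ∈ x B + B` for the generators `g` of `B`, the algebra generated by `B` and `x` is the
sum of the spaces `x ^ n * B`. -/
theorem adjoin_insert_le_powSpan {x : R} {s : Set R}
    (h : ∀ g ∈ s, ∃ b ∈ Algebra.adjoin K s, ∃ b' ∈ Algebra.adjoin K s, g * x = x * b + b') :
    ∀ y ∈ Algebra.adjoin K (insert x s), y ∈ powSpan x (Algebra.adjoin K s) := by
  set B := Algebra.adjoin K s
  -- The straightening property passes from generators to all of B: it is stable under sums and
  -- products.
  have hB : ∀ c ∈ B, ∃ b ∈ B, ∃ b' ∈ B, c * x = x * b + b' := by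
    intro c hc
    induction hc using Algebra.adjoin_induction with
    | mem g hg => exact h g hg
    | algebraMap r =>
      exact ⟨algebraMap K R r, B.algebraMap_mem r, 0, zero_mem _, by
        rw [Algebra.commutes, add_zero]⟩
    | add a c _ _ ha hc =>
      obtain ⟨b, hb, b', hb', e⟩ := ha
      obtain ⟨d, hd, d', hd', e'⟩ := hc
      exact ⟨b + d, add_mem hb hd, b' + d', add_mem hb' hd', by rw [add_mul, e, e', mul_add]; abel⟩
    | mul a c ha' hc' ha hc =>
      obtain ⟨d, hd, d', hd', e'⟩ := hc
      obtain ⟨b, hb, b', hb', e⟩ := ha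
      refine ⟨b * d, mul_mem hb hd, b' * d + a * d', add_mem (mul_mem hb' hd) (mul_mem ha' hd'), ?_⟩
      rw [mul_assoc, e', mul_add, ← mul_assoc, e, add_mul, mul_assoc]
      abel
  have hx : ∀ y ∈ powSpan x B, x * y ∈ powSpan x B := by
    intro y hy
    induction hy using Submodule.span_induction with
    | mem y hy =>
      obtain ⟨n, b, hb, rfl⟩ := hy
      rw [← mul_assoc, ← pow_succ']
      exact pow_mul_mem_powSpan _ hb
    | zero => rw [mul_zero]; exact zero_mem _
    | add y z _ _ hy hz => rw [mul_add]; exact add_mem hy hz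
    | smul r y _ hy => rw [mul_smul_comm]; exact Submodule.smul_mem _ _ hy
  have hpow : ∀ n : ℕ, ∀ c ∈ B, ∀ b ∈ B, c * (x ^ n * b) ∈ powSpan x B := by
    intro n
    induction n with
    | zero =>
      intro c hc b hb
      simpa using pow_mul_mem_powSpan (x := x) 0 (mul_mem hc hb)
    | succ n ih =>
      intro c hc b hb
      obtain ⟨d, hd, d', hd', e⟩ := hB c hc
      rw [pow_succ', mul_assoc x, ← mul_assoc c, e, add_mul, mul_assoc x]
      exact add_mem (hx _ (ih d hd b hb)) (ih d' hd' b hb)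
  have hBp : ∀ c ∈ B, ∀ y ∈ powSpan x B, c * y ∈ powSpan x B := by
    intro c hc y hy
    induction hy using Submodule.span_induction with
    | mem y hy =>
      obtain ⟨n, b, hb, rfl⟩ := hy
      exact hpow n c hc b hb
    | zero => rw [mul_zero]; exact zero_mem _
    | add y z _ _ hy hz => rw [mul_add]; exact add_mem hy hz
    | smul r y _ hy => rw [mul_smul_comm]; exact Submodule.smul_mem _ _ hy
  -- The sum of the x ^ n * B is stable under left multiplication by x and by B; as it contains 1,
  -- it contains the whole algebra they generate.
  have hmul : ∀ y ∈ Algebra.adjoin K (insert x s), ∀ z ∈ powSpan x B, y * z ∈ powSpan x B := by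
    intro y hy
    induction hy using Algebra.adjoin_induction with
    | mem g hg =>
      rcases hg with rfl | hg
      · exact hx
      · exact hBp g (Algebra.subset_adjoin hg)
    | algebraMap r =>
      intro z hz
      rw [← Algebra.smul_def]
      exact Submodule.smul_mem _ _ hz
    | add a c _ _ ha hc =>
      intro z hz
      rw [add_mul]
      exact add_mem (ha z hz) (hc z hz)
    | mul a c _ _ ha hc =>
      intro z hz
      rw [mul_assoc]
      exact ha _ (hc z hz)
  intro y hy
  have h1 : (1 : R) ∈ powSpan x B := by
    simpa using pow_mul_mem_powSpan (x := x) 0 (one_mem B)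
  simpa using hmul y hy 1 h1

/-- If `B` is spanned by a family `m`, then `∑ x ^ n * B` is spanned by the `x ^ n * m i`. -/
theorem powSpan_le_span {ι : Type*} {x : R} {B : Subalgebra K R} {m : ι → R}
    (h : ∀ b ∈ B, b ∈ Submodule.span K (Set.range m)) :
    powSpan x B ≤ Submodule.span K (Set.range fun p : ℕ × ι => x ^ p.1 * m p.2) := by
  refine Submodule.span_le.2 ?_
  rintro _ ⟨n, b, hb, rfl⟩
  have hb' := h b hb
  clear hb
  induction hb' using Submodule.span_induction with
  | mem y hy =>
    obtain ⟨i, rfl⟩ := hy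
    exact Submodule.subset_span ⟨(n, i), rfl⟩
  | zero => rw [mul_zero]; exact zero_mem _
  | add y z _ _ hy hz => rw [mul_add]; exact add_mem hy hz
  | smul r y _ hy => rw [mul_smul_comm]; exact Submodule.smul_mem _ _ hy

/-- The algebra generated by one element is spanned by its powers. -/
theorem adjoin_singleton_le_span (x : R) :
    ∀ b ∈ Algebra.adjoin K {x}, b ∈ Submodule.span K (Set.range fun n : ℕ => x ^ n) := by
  intro b hb
  rw [Algebra.adjoin_singleton_eq_range_aeval] at hb
  obtain ⟨p, rfl⟩ := hb
  change Polynomial.aeval x p ∈ _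
  rw [Polynomial.aeval_eq_sum_range]
  exact sum_mem fun i _ => Submodule.smul_mem _ _ (Submodule.subset_span ⟨i, rfl⟩)

theorem adjoin_insert_le_span {ι : Type*} {x : R} {s : Set R} {m : ι → R}
    (h : ∀ g ∈ s, ∃ b ∈ Algebra.adjoin K s, ∃ b' ∈ Algebra.adjoin K s, g * x = x * b + b')
    (hm : ∀ b ∈ Algebra.adjoin K s, b ∈ Submodule.span K (Set.range m)) :
    ∀ b ∈ Algebra.adjoin K (insert x s),
      b ∈ Submodule.span K (Set.range fun p : ℕ × ι => x ^ p.1 * m p.2) :=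
  fun b hb => powSpan_le_span hm (adjoin_insert_le_powSpan h b hb)

end Spanning

/-! ### The PBW spanning family -/

section PBW

/-- The ordered monomials in six elements. -/
def pbw {R : Type v} [Ring R] (x₁ x₂ x₃ x₄ x₅ x₆ : R) (p : ℕ × ℕ × ℕ × ℕ × ℕ × ℕ) : R :=
  x₁ ^ p.1 * (x₂ ^ p.2.1 * (x₃ ^ p.2.2.1 * (x₄ ^ p.2.2.2.1 * (x₅ ^ p.2.2.2.2.1 *
    x₆ ^ p.2.2.2.2.2))))

theorem exists_straighten {K : Type u} [Field K] {R : Type v} [Ring R] [Algebra K R] {x g d : R}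
    {s : Set R} (hg : g ∈ s) {c : K} (hd : d ∈ Algebra.adjoin K s) (h : g * x = c • (x * g) + d) :
    ∃ b ∈ Algebra.adjoin K s, ∃ b' ∈ Algebra.adjoin K s, g * x = x * b + b' :=
  ⟨c • g, Subalgebra.smul_mem _ (Algebra.subset_adjoin hg) c, d, hd, by rw [h, mul_smul_comm]⟩

variable {K : Type u} [Field K] {q : K} {R : Type v} [Ring R] [Algebra K R]
  {x₁ x₂ x₃ x₄ x₅ x₆ : R}

/-- The relations are of Levendorskii–Soibelman type: the correction to xⱼxᵢ with i < j involves
only root vectors strictly between xᵢ and xⱼ, so it never contains x₁ here. The four analogues below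
rest on the same fact. -/
theorem RootVectorRelations.straighten_one (H : RootVectorRelations q x₁ x₂ x₃ x₄ x₅ x₆)
    (hq0 : q ≠ 0) (hq : ∀ n : ℕ, 0 < n → q ^ n ≠ 1) :
    ∀ g ∈ ({x₂, x₃, x₄, x₅, x₆} : Set R), ∃ b ∈ Algebra.adjoin K {x₂, x₃, x₄, x₅, x₆},
      ∃ b' ∈ Algebra.adjoin K {x₂, x₃, x₄, x₅, x₆}, g * x₁ = x₁ * b + b' := by
  have mem : ∀ {y : R}, y ∈ ({x₂, x₃, x₄, x₅, x₆} : Set R) →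
      y ∈ Algebra.adjoin K {x₂, x₃, x₄, x₅, x₆} :=
    fun h => Algebra.subset_adjoin h
  have smem : ∀ {y : R} (c : K), y ∈ Algebra.adjoin K {x₂, x₃, x₄, x₅, x₆} →
      c • y ∈ Algebra.adjoin K {x₂, x₃, x₄, x₅, x₆} :=
    fun c h => Subalgebra.smul_mem _ h c
  rintro g (rfl | rfl | rfl | rfl | rfl)
  · refine exists_straighten (by simp) (zero_mem _) (by rw [add_zero]; exact H.r21)
  · refine exists_straighten (by simp) (neg_mem (smem _ (mem ?_)))
      (by rw [← sub_eq_add_neg]; exact H.r31)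
    simp
  · refine exists_straighten (c := (1 : K)) (d := (1 - q ^ 2) • (x₃ * x₃))
      (by simp) (smem _ (mul_mem (mem ?_) (mem ?_)))
      (by rw [one_smul]; exact H.r41 hq0 hq) <;> simp
  · refine exists_straighten (by simp) (neg_mem (smem _ (mem ?_)))
      (by rw [← sub_eq_add_neg]; exact H.r51)
    simp
  · refine exists_straighten (by simp) (neg_mem (smem _ (mem ?_)))
      (by rw [← sub_eq_add_neg]; exact H.r61)
    simp

theorem RootVectorRelations.straighten_two (H : RootVectorRelations q x₁ x₂ x₃ x₄ x₅ x₆)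
    (hq0 : q ≠ 0) (hq : ∀ n : ℕ, 0 < n → q ^ n ≠ 1) :
    ∀ g ∈ ({x₃, x₄, x₅, x₆} : Set R), ∃ b ∈ Algebra.adjoin K {x₃, x₄, x₅, x₆},
      ∃ b' ∈ Algebra.adjoin K {x₃, x₄, x₅, x₆}, g * x₂ = x₂ * b + b' := by
  have mem : ∀ {y : R}, y ∈ ({x₃, x₄, x₅, x₆} : Set R) → y ∈ Algebra.adjoin K {x₃, x₄, x₅, x₆} :=
    fun h => Algebra.subset_adjoin h
  have smem : ∀ {y : R} (c : K), y ∈ Algebra.adjoin K {x₃, x₄, x₅, x₆} →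
      c • y ∈ Algebra.adjoin K {x₃, x₄, x₅, x₆} :=
    fun c h => Subalgebra.smul_mem _ h c
  rintro g (rfl | rfl | rfl | rfl)
  · exact exists_straighten (by simp) (zero_mem _) (by rw [add_zero]; exact H.r32 hq0 hq)
  · refine exists_straighten (by simp)
      (neg_mem (smem _ (mul_mem (mem ?_) (mul_mem (mem ?_) (mem ?_)))))
      (by rw [← sub_eq_add_neg]; exact H.r42 hq0 hq) <;> simp
  · refine exists_straighten (c := (1 : K)) (d := (1 - q ^ 2) • (x₃ * x₃))
      (by simp) (smem _ (mul_mem (mem ?_) (mem ?_)))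
      (by rw [one_smul]; exact H.r52 hq0 hq) <;> simp
  · refine exists_straighten (by simp)
      (add_mem (smem _ (mem ?_)) (smem _ (mul_mem (mem ?_) (mem ?_))))
      (by rw [← add_assoc]; exact H.r62 hq0 hq) <;> simp

theorem RootVectorRelations.straighten_three (H : RootVectorRelations q x₁ x₂ x₃ x₄ x₅ x₆)
    (hq0 : q ≠ 0) (hq : ∀ n : ℕ, 0 < n → q ^ n ≠ 1) :
    ∀ g ∈ ({x₄, x₅, x₆} : Set R), ∃ b ∈ Algebra.adjoin K {x₄, x₅, x₆},
      ∃ b' ∈ Algebra.adjoin K {x₄, x₅, x₆}, g * x₃ = x₃ * b + b' := by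
  have mem : ∀ {y : R}, y ∈ ({x₄, x₅, x₆} : Set R) → y ∈ Algebra.adjoin K {x₄, x₅, x₆} :=
    fun h => Algebra.subset_adjoin h
  have smem : ∀ {y : R} (c : K), y ∈ Algebra.adjoin K {x₄, x₅, x₆} →
      c • y ∈ Algebra.adjoin K {x₄, x₅, x₆} :=
    fun c h => Subalgebra.smul_mem _ h c
  rintro g (rfl | rfl | rfl)
  · exact exists_straighten (by simp) (zero_mem _) (by rw [add_zero]; exact H.r43 hq0 hq)
  · refine exists_straighten (by simp) (neg_mem (smem _ (mem ?_)))
      (by rw [← sub_eq_add_neg]; exact H.r53)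
    simp
  · refine exists_straighten (c := (1 : K)) (d := (1 - q ^ 2) • (x₅ * x₅))
      (by simp) (smem _ (mul_mem (mem ?_) (mem ?_)))
      (by rw [one_smul]; exact H.r63 hq0 hq) <;> simp

theorem RootVectorRelations.straighten_four (H : RootVectorRelations q x₁ x₂ x₃ x₄ x₅ x₆)
    (hq0 : q ≠ 0) (hq : ∀ n : ℕ, 0 < n → q ^ n ≠ 1) :
    ∀ g ∈ ({x₅, x₆} : Set R), ∃ b ∈ Algebra.adjoin K {x₅, x₆},
      ∃ b' ∈ Algebra.adjoin K {x₅, x₆}, g * x₄ = x₄ * b + b' := by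
  have mem : ∀ {y : R}, y ∈ ({x₅, x₆} : Set R) → y ∈ Algebra.adjoin K {x₅, x₆} :=
    fun h => Algebra.subset_adjoin h
  have smem : ∀ {y : R} (c : K), y ∈ Algebra.adjoin K {x₅, x₆} →
      c • y ∈ Algebra.adjoin K {x₅, x₆} :=
    fun c h => Subalgebra.smul_mem _ h c
  rintro g (rfl | rfl)
  · exact exists_straighten (by simp) (zero_mem _) (by rw [add_zero]; exact H.r54 hq0 hq)
  · refine exists_straighten (by simp)
      (neg_mem (smem _ (mul_mem (mem ?_) (mul_mem (mem ?_) (mem ?_)))))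
      (by rw [← sub_eq_add_neg]; exact H.r64 hq0 hq) <;> simp

theorem RootVectorRelations.straighten_five (H : RootVectorRelations q x₁ x₂ x₃ x₄ x₅ x₆) :
    ∀ g ∈ ({x₆} : Set R), ∃ b ∈ Algebra.adjoin K {x₆},
      ∃ b' ∈ Algebra.adjoin K {x₆}, g * x₅ = x₅ * b + b' := by
  rintro g rfl
  exact exists_straighten (by simp) (zero_mem _) (by rw [add_zero]; exact H.r65)

/-- The algebra is built up from x₆ by adjoining x₅, x₄, …, x₁ on the left. Only spanning is
claimed; independence comes later from leading exponents. -/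
theorem RootVectorRelations.adjoin_le_span_pbw (H : RootVectorRelations q x₁ x₂ x₃ x₄ x₅ x₆)
    (hq0 : q ≠ 0) (hq : ∀ n : ℕ, 0 < n → q ^ n ≠ 1) :
    ∀ y ∈ Algebra.adjoin K {x₁, x₂, x₃, x₄, x₅, x₆},
      y ∈ Submodule.span K (Set.range (pbw x₁ x₂ x₃ x₄ x₅ x₆)) := by
  have h5 := adjoin_insert_le_span (H.straighten_five) (adjoin_singleton_le_span x₆)
  have h4 := adjoin_insert_le_span (H.straighten_four hq0 hq) h5
  have h3 := adjoin_insert_le_span (H.straighten_three hq0 hq) h4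
  have h2 := adjoin_insert_le_span (H.straighten_two hq0 hq) h3
  have h1 := adjoin_insert_le_span (H.straighten_one hq0 hq) h2
  intro y hy
  refine Submodule.span_mono ?_ (h1 y hy)
  rintro _ ⟨p, rfl⟩
  exact ⟨p, rfl⟩

theorem adjoin_E1_E6 : Algebra.adjoin K {E1 q, E6 q} = ⊤ := by
  have h := congrArg (Subalgebra.map (RingQuot.mkAlgHom K (SerreRel q)))
    (FreeAlgebra.adjoin_range_ι K SimpleRoot)
  rw [Algebra.map_top, (AlgHom.range_eq_top _).2 (RingQuot.mkAlgHom_surjective K _),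
    AlgHom.map_adjoin] at h
  rw [← top_le_iff, ← h]
  refine Algebra.adjoin_mono ?_
  rintro _ ⟨_, ⟨i, rfl⟩, rfl⟩
  cases i
  · exact Or.inl rfl
  · exact Or.inr rfl

theorem span_pbw_eq_top (hq0 : q ≠ 0) (hq : ∀ n : ℕ, 0 < n → q ^ n ≠ 1) :
    Submodule.span K (Set.range (pbw (E1 q) (E2 q) (E3 q) (E4 q) (E5 q) (E6 q))) = ⊤ := by
  rw [eq_top_iff]
  intro y _
  refine (rootVectorRelations hq0 hq).adjoin_le_span_pbw hq0 hq y ?_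
  have hy : y ∈ Algebra.adjoin K {E1 q, E6 q} := by rw [adjoin_E1_E6]; trivial
  refine Algebra.adjoin_mono ?_ hy
  rintro _ (rfl | rfl) <;> simp

end PBW

/-! ### Leading exponents -/

section Lead

theorem expo_inj {a b c d e f a' b' c' d' e' f' : ℤ}
    (h : expo a b c d e f = expo a' b' c' d' e' f') :
    a = a' ∧ b = b' ∧ c = c' ∧ d = d' ∧ e = e' ∧ f = f' := by
  have h' : ![a, b, c, d, e, f] = ![a', b', c', d', e', f'] := toLex.injective h
  exact ⟨congrFun h' 0, congrFun h' 1, congrFun h' 2, congrFun h' 3, congrFun h' 4, congrFun h' 5⟩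

theorem zsmul_expo (n a b c d e f : ℤ) :
    n • expo a b c d e f = expo (n * a) (n * b) (n * c) (n * d) (n * e) (n * f) := by
  induction n with
  | zero =>
    rw [zero_zsmul]
    refine congrArg toLex (funext fun i => ?_)
    fin_cases i <;> simp
  | succ n ih => rw [add_zsmul, ih, one_zsmul, expo_add]; congr 1 <;> ring
  | pred n ih =>
    rw [sub_zsmul, ih, one_zsmul, ← sub_eq_add_neg, sub_eq_iff_eq_add, expo_add]
    congr 1 <;> ring

theorem smul_expo (n : ℕ) (a b c d e f : ℤ) :
    n • expo a b c d e f = expo (n * a) (n * b) (n * c) (n * d) (n * e) (n * f) := by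
  rw [← natCast_zsmul, zsmul_expo]

theorem toLex_lt_toLex_of {u v : Fin 6 → ℤ} (i : Fin 6) (h : ∀ j < i, u j = v j)
    (hi : u i < v i) : toLex u < toLex v :=
  ⟨i, h, hi⟩

/-- The later exponents may be negative: in the lexicographic order they do not matter. This makes
Tᵢ the leading monomial of eᵢ, whose other terms involve only later variables. -/
theorem expo_lt_one {b c d e f : ℤ} : expo 0 b c d e f < expo 1 0 0 0 0 0 :=
  toLex_lt_toLex_of 0 (by simp) (by simp)

theorem expo_lt_two {c d e f : ℤ} : expo 0 0 c d e f < expo 0 1 0 0 0 0 :=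
  toLex_lt_toLex_of 1 (by simp) (by simp)

theorem expo_lt_three {d e f : ℤ} : expo 0 0 0 d e f < expo 0 0 1 0 0 0 :=
  toLex_lt_toLex_of 2 (by simp [Fin.forall_fin_succ]) (by simp)

theorem expo_lt_four {e f : ℤ} : expo 0 0 0 0 e f < expo 0 0 0 1 0 0 :=
  toLex_lt_toLex_of 3 (by simp [Fin.forall_fin_succ]) (by simp)

variable {K : Type u} [Field K] {q : K}

theorem mono_mem {hq0 : q ≠ 0} {g : Exponent} {a b c d e f : ℤ} (h : expo a b c d e f < g) :
    mono hq0 a b c d e f ∈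
      Submodule.span K (X (Units.mk0 q hq0) form '' Set.Iio g) :=
  Submodule.subset_span ⟨_, h, rfl⟩

theorem hasLead_mono_add {hq0 : q ≠ 0} {a b c d e f : ℤ} {r : Torus hq0}
    (hr : r ∈ Submodule.span K (X (Units.mk0 q hq0) form '' Set.Iio (expo a b c d e f))) :
    HasLead (mono hq0 a b c d e f + r) (expo a b c d e f) := by
  have := hasLead_smul_X_add (one_ne_zero (α := K)) hr
  rwa [one_smul] at this

variable (hq0 : q ≠ 0)

theorem hasLead_e1 : HasLead (e1 hq0) (expo 1 0 0 0 0 0) := by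
  simp only [e1, add_assoc]
  refine hasLead_mono_add ?_
  repeat' apply add_mem
  all_goals exact Submodule.smul_mem _ _ (mono_mem expo_lt_one)

theorem hasLead_e2 : HasLead (e2 hq0) (expo 0 1 0 0 0 0) := by
  simp only [e2, add_assoc]
  refine hasLead_mono_add ?_
  repeat' apply add_mem
  all_goals exact Submodule.smul_mem _ _ (mono_mem expo_lt_two)

theorem hasLead_e3 : HasLead (e3 hq0) (expo 0 0 1 0 0 0) := by
  simp only [e3, add_assoc]
  refine hasLead_mono_add ?_
  repeat' apply add_mem
  all_goals exact Submodule.smul_mem _ _ (mono_mem expo_lt_three)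

theorem hasLead_e4 : HasLead (e4 hq0) (expo 0 0 0 1 0 0) :=
  hasLead_mono_add (Submodule.smul_mem _ _ (mono_mem expo_lt_four))

theorem hasLead_mono (a b c d e f : ℤ) : HasLead (mono hq0 a b c d e f) (expo a b c d e f) := by
  have := hasLead_mono_add (hq0 := hq0) (r := 0) (a := a) (b := b) (c := c) (d := d) (e := e)
    (f := f) (zero_mem _)
  rwa [add_zero] at this

/-- The exponent of an ordered monomial. -/
def pbwExpo (p : ℕ × ℕ × ℕ × ℕ × ℕ × ℕ) : Exponent :=
  expo p.1 p.2.1 p.2.2.1 p.2.2.2.1 p.2.2.2.2.1 p.2.2.2.2.2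

theorem pbwExpo_injective : Function.Injective pbwExpo := by
  rintro ⟨a, b, c, d, e, f⟩ ⟨a', b', c', d', e', f'⟩ h
  have := expo_inj h
  simp only [Nat.cast_inj] at this
  obtain ⟨rfl, rfl, rfl, rfl, rfl, rfl⟩ := this
  rfl

theorem hasLead_pbw (p : ℕ × ℕ × ℕ × ℕ × ℕ × ℕ) :
    HasLead (pbw (e1 hq0) (e2 hq0) (e3 hq0) (e4 hq0) (e5 hq0) (e6 hq0) p) (pbwExpo p) := by
  have h := ((hasLead_e1 hq0).pow p.1).mul (((hasLead_e2 hq0).pow p.2.1).mul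
    (((hasLead_e3 hq0).pow p.2.2.1).mul (((hasLead_e4 hq0).pow p.2.2.2.1).mul
    (((hasLead_mono hq0 0 0 0 0 1 0).pow p.2.2.2.2.1).mul
      ((hasLead_mono hq0 0 0 0 0 0 1).pow p.2.2.2.2.2)))))
  simp only [smul_expo, expo_add, mul_one, mul_zero, add_zero, zero_add] at h
  exact h

variable (hq : ∀ n : ℕ, 0 < n → q ^ n ≠ 1)

/-- The leading exponent of the image of a nonzero element of `U_q^+(G_2)` is nonnegative. -/
theorem exists_hasLead_toTorus {z : UqPlus q} (hz : z ≠ 0) :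
    ∃ p, HasLead (toTorus hq0 hq z) (pbwExpo p) := by
  have hmem : z ∈ Submodule.span K (Set.range (pbw (E1 q) (E2 q) (E3 q) (E4 q) (E5 q) (E6 q))) := by
    rw [span_pbw_eq_top hq0 hq]; trivial
  obtain ⟨c, rfl⟩ := (Finsupp.mem_span_range_iff_exists_finsupp).1 hmem
  have hc : c ≠ 0 := by
    rintro rfl
    exact hz (Finsupp.sum_zero_index)
  obtain ⟨p, hp⟩ := exists_hasLead_linearCombination pbwExpo_injective (hasLead_pbw hq0) hc
  refine ⟨p, ?_⟩
  convert hp using 1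
  rw [Finsupp.linearCombination_apply, map_finsuppSum]
  simp only [map_smul, pbw, map_mul, map_pow, toTorus_E1, toTorus_E2, toTorus_E3, toTorus_E4,
    toTorus_E5, toTorus_E6]

/-- A nonzero element is a nontrivial combination of ordered monomials, whose images have distinct
leading exponents; so its image has a leading term. -/
theorem toTorus_injective : Function.Injective (toTorus hq0 hq) := by
  rw [injective_iff_map_eq_zero]
  intro z hz
  by_contra hne
  obtain ⟨p, hp⟩ := exists_hasLead_toTorus hq0 hq hne
  exact hp.ne_zero hz

end Lead

/-! ### The Ore condition from polynomial growth -/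

section Ore

/-- Exponential growth beats polynomial growth; the exponent 6 is the number of torus variables. -/
theorem exists_pow_lt_two_pow (d : ℕ) : ∃ k : ℕ, (2 * (k * d) + 1) ^ 6 < 2 ^ k := by
  have h := tendsto_pow_const_div_const_pow_of_one_lt 6 (one_lt_two (α := ℝ))
  have hC : (0 : ℝ) < 1 / (2 * d + 1) ^ 6 := by positivity
  obtain ⟨k, hk, hk1⟩ := ((h.eventually_lt_const hC).and (Filter.eventually_ge_atTop 1)).exists
  refine ⟨k, ?_⟩
  rw [div_lt_div_iff₀ (by positivity) (by positivity), one_mul, ← mul_pow] at hk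
  have h1 : (2 * (k * d) + 1) ^ 6 ≤ (k * (2 * d + 1)) ^ 6 := by
    refine Nat.pow_le_pow_left ?_ 6
    nlinarith
  refine lt_of_le_of_lt h1 ?_
  exact_mod_cast hk

/-- A domain with a filtration of polynomial growth satisfies the left Ore condition. -/
theorem exists_mul_eq_mul_of_growth {K : Type u} [Field K] {R : Type v} [Ring R] [Algebra K R]
    [NoZeroDivisors R] [Nontrivial R] (V : ℕ → Submodule K R)
    (hfin : ∀ n, Module.Finite K (V n)) (hmono : Monotone V) (hone : 1 ∈ V 0)
    (hmul : ∀ {m n a b}, a ∈ V m → b ∈ V n → a * b ∈ V (m + n)) (hex : ∀ a, ∃ n, a ∈ V n)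
    (hgrowth : ∀ n, Module.finrank K (V n) ≤ (2 * n + 1) ^ 6) (r : R) {s : R} (hs : s ≠ 0) :
    ∃ r' s', s' ≠ 0 ∧ s' * r = r' * s := by
  by_contra! hcon
  obtain ⟨m, hm⟩ := hex r
  obtain ⟨n, hn⟩ := hex s
  set d := max m n
  have hr : r ∈ V d := hmono (le_max_left _ _) hm
  have hs' : s ∈ V d := hmono (le_max_right _ _) hn
  -- If no common left multiple exists, (x, y) ↦ x r - y s is injective on V k × V k, so each shift
  -- by d at least doubles the dimension.
  have hdouble : ∀ k, 2 * Module.finrank K (V k) ≤ Module.finrank K (V (k + d)) := by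
    intro k
    let f : (V k × V k) →ₗ[K] V (k + d) := LinearMap.codRestrict (V (k + d))
      ((LinearMap.mulRight K r).comp ((V k).subtype.comp (LinearMap.fst K _ _))
        - (LinearMap.mulRight K s).comp ((V k).subtype.comp (LinearMap.snd K _ _)))
      (fun x => sub_mem (hmul x.1.2 hr) (hmul x.2.2 hs'))
    have hf : Function.Injective f := by
      rw [injective_iff_map_eq_zero]
      rintro ⟨x, y⟩ hxy
      have h1 : (x : R) * r - y * s = 0 := congrArg Subtype.val hxy
      have hx : (x : R) = 0 := by
        by_contra hx
        exact hcon y x hx (sub_eq_zero.1 h1)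
      rw [hx, zero_mul, zero_sub, neg_eq_zero] at h1
      have hy : (y : R) = 0 := (mul_eq_zero.1 h1).resolve_right hs
      exact Prod.ext (Subtype.ext hx) (Subtype.ext hy)
    have := hfin
    have h2 := LinearMap.finrank_le_finrank_of_injective hf
    rw [Module.finrank_prod] at h2
    omega
  -- Iterating from dim V 0 ≥ 1 gives dimension at least 2 ^ k in V (k * d), against the polynomial
  -- bound.
  have hpow : ∀ k, 2 ^ k ≤ Module.finrank K (V (k * d)) := by
    intro k
    induction k with
    | zero =>
      have := hfin
      rw [pow_zero, zero_mul, Nat.one_le_iff_ne_zero, ← Nat.pos_iff_ne_zero,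
        Module.finrank_pos_iff]
      exact ⟨⟨⟨1, hone⟩, 0, fun h => one_ne_zero (congrArg Subtype.val h)⟩⟩
    | succ k ih =>
      rw [pow_succ', add_mul, one_mul]
      exact (Nat.mul_le_mul_left 2 ih).trans (hdouble _)
  obtain ⟨k, hk⟩ := exists_pow_lt_two_pow d
  exact absurd ((hpow k).trans (hgrowth _)) (not_le.2 hk)

/-- The exponents all of whose coordinates are bounded by `n` in absolute value. -/
def box (n : ℕ) : Finset Exponent :=
  (Fintype.piFinset fun _ : Fin 6 => Finset.Icc (-n : ℤ) n).map toLex.toEmbedding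

theorem mem_box {n : ℕ} {g : Exponent} : g ∈ box n ↔ ∀ i, |ofLex g i| ≤ n := by
  simp only [box, Finset.mem_map_equiv, Fintype.mem_piFinset, Finset.mem_Icc, abs_le]
  rfl

theorem card_box (n : ℕ) : (box n).card = (2 * n + 1) ^ 6 := by
  rw [box, Finset.card_map, Fintype.card_piFinset_const, Int.card_Icc]
  congr 1
  omega

variable {K : Type u} [Field K] {q : K} {hq0 : q ≠ 0}

/-- The subspace of the quantum torus spanned by the monomials with exponents in `box n`. -/
def boxSpan (hq0 : q ≠ 0) (n : ℕ) : Submodule K (Torus hq0) :=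
  Submodule.span K (X (Units.mk0 q hq0) form '' (box n : Set Exponent))

instance (n : ℕ) : Module.Finite K (boxSpan hq0 n) :=
  Module.Finite.span_of_finite K ((Finset.finite_toSet _).image _)

theorem finrank_boxSpan (n : ℕ) : Module.finrank K (boxSpan hq0 n) ≤ (2 * n + 1) ^ 6 := by
  classical
  rw [boxSpan, ← Finset.coe_image]
  exact (finrank_span_finset_le_card _).trans (Finset.card_image_le.trans (card_box n).le)

theorem exists_mem_boxSpan (f : Torus hq0) : ∃ n, f ∈ boxSpan hq0 n := by
  refine ⟨(supp f).sup fun g => Finset.univ.sup fun i => (ofLex g i).natAbs, ?_⟩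
  rw [boxSpan, mem_span_X_iff]
  intro g hg
  rw [Finset.mem_coe, mem_box]
  intro i
  rw [Int.abs_eq_natAbs, Nat.cast_le]
  exact (Finset.le_sup (f := fun i => (ofLex g i).natAbs) (Finset.mem_univ i)).trans
    (Finset.le_sup (f := fun g : Exponent => Finset.univ.sup fun i => (ofLex g i).natAbs)
      (mem_supp.2 hg))

/-- Subalgebras of the quantum torus satisfy the left Ore condition. -/
theorem exists_mul_eq_mul {R : Type v} [Ring R] [Algebra K R] [NoZeroDivisors R] [Nontrivial R]
    {φ : R →ₐ[K] Torus hq0} (hφ : Function.Injective φ) (r : R) {s : R} (hs : s ≠ 0) :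
    ∃ r' s', s' ≠ 0 ∧ s' * r = r' * s := by
  have hinj : ∀ n, Function.Injective (((φ : R →ₗ[K] Torus hq0).restrict
      (p := (boxSpan hq0 n).comap (φ : R →ₗ[K] Torus hq0)) (q := boxSpan hq0 n) fun x hx => hx)) :=
    fun n x y h => Subtype.ext (hφ (congrArg Subtype.val h))
  -- The filtration is pulled back from the boxes of exponents, whose sizes add under
  -- multiplication.
  refine exists_mul_eq_mul_of_growth
    (fun n => (boxSpan hq0 n).comap (φ : R →ₗ[K] Torus hq0)) (fun n => ?_) ?_ ?_ ?_ ?_ ?_ r hs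
  · exact Module.Finite.of_injective _ (hinj n)
  · intro m n hmn
    refine Submodule.comap_mono (Submodule.span_mono (Set.image_mono fun g hg => ?_))
    rw [Finset.mem_coe, mem_box] at hg ⊢
    exact fun i => (hg i).trans (by exact_mod_cast hmn)
  · refine Submodule.mem_comap.2 ?_
    change φ 1 ∈ _
    rw [map_one, one_def]
    refine Submodule.subset_span ⟨0, ?_, rfl⟩
    rw [Finset.mem_coe, mem_box]
    intro i
    change |(0 : ℤ)| ≤ _
    simp
  · intro m n a b ha hb
    refine Submodule.mem_comap.2 ?_
    change φ (a * b) ∈ _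
    rw [map_mul]
    refine mul_mem_span_X ?_ ha hb
    intro g hg h hh
    rw [Finset.mem_coe, mem_box] at hg hh ⊢
    intro i
    rw [ofLex_add, Pi.add_apply, Nat.cast_add]
    exact (abs_add_le _ _).trans (add_le_add (hg i) (hh i))
  · exact fun a => exists_mem_boxSpan (φ a)
  · exact fun n => (LinearMap.finrank_le_finrank_of_injective (hinj n)).trans (finrank_boxSpan n)

end Ore

/-! ### Skew fields of fractions -/

section Fractions

open nonZeroDivisors

/-- The localisation of an Ore domain at all its nonzero elements is a skew field of fractions. -/
theorem exists_isSkewFieldOfFractions {K : Type u} [Field K] {A : Type u} [Ring A] [Algebra K A]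
    [NoZeroDivisors A] [Nontrivial A]
    (h : ∀ (r : A) {s : A}, s ≠ 0 → ∃ r' s', s' ≠ 0 ∧ s' * r = r' * s) :
    ∃ (F : Type u) (_ : DivisionRing F) (_ : Algebra K F) (ι : A →ₐ[K] F),
      IsSkewFieldOfFractions ι := by
  obtain ⟨hO⟩ : Nonempty (OreLocalization.OreSet A⁰) := by
    rw [OreLocalization.nonempty_oreSet_iff_of_noZeroDivisors]
    intro r s
    obtain ⟨r', s', hs', e⟩ := h r (nonZeroDivisors.ne_zero s.2)
    exact ⟨r', ⟨s', mem_nonZeroDivisors_of_ne_zero hs'⟩, e⟩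
  refine ⟨OreLocalization A⁰ A, inferInstance, inferInstance,
    { OreLocalization.numeratorRingHom with commutes' := fun _ => rfl }, ?_, ?_⟩
  · exact OreLocalization.numeratorHom_inj (S := A⁰) (fun x hx => hx.1)
  · intro x
    induction x using OreLocalization.ind with
    | _ r s =>
    refine ⟨r, s, nonZeroDivisors.ne_zero s.2, ?_⟩
    have hs : (OreLocalization.numeratorHom (s : A) : OreLocalization A⁰ A) ≠ 0 := by
      intro h0
      refine nonZeroDivisors.ne_zero s.2
        (OreLocalization.numeratorHom_inj (S := A⁰) (fun x hx => hx.1) ?_)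
      rw [h0]
      exact ((OreLocalization.numeratorRingHom (S := A⁰)).map_zero).symm
    change _ = (OreLocalization.numeratorHom (s : A))⁻¹ * OreLocalization.numeratorHom r
    rw [eq_inv_mul_iff_mul_eq₀ hs]
    simp [OreLocalization.numeratorHom_apply]

/-- An embedding of an Ore domain into a division ring extends to its skew field of fractions. -/
theorem IsSkewFieldOfFractions.exists_extension {K : Type u} [Field K] {A : Type u} [Ring A]
    [Algebra K A] [NoZeroDivisors A] [Nontrivial A]
    (h : ∀ (r : A) {s : A}, s ≠ 0 → ∃ r' s', s' ≠ 0 ∧ s' * r = r' * s)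
    {F : Type v} [DivisionRing F] [Algebra K F] {ι : A →ₐ[K] F} (hι : IsSkewFieldOfFractions ι)
    {Q : Type w} [DivisionRing Q] [Algebra K Q] {κ : A →ₐ[K] Q} (hκ : Function.Injective κ) :
    ∃ ρ : F →ₐ[K] Q, ∀ a, ρ (ι a) = κ a := by
  obtain ⟨hO⟩ : Nonempty (OreLocalization.OreSet A⁰) := by
    rw [OreLocalization.nonempty_oreSet_iff_of_noZeroDivisors]
    intro r s
    obtain ⟨r', s', hs', e⟩ := h r (nonZeroDivisors.ne_zero s.2)
    exact ⟨r', ⟨s', mem_nonZeroDivisors_of_ne_zero hs'⟩, e⟩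
  have hιu : ∀ s : A⁰, IsUnit (((ι : A →* F).comp A⁰.subtype) s) := fun s =>
    isUnit_iff_ne_zero.2 ((map_ne_zero_iff ι hι.injective).2 (nonZeroDivisors.ne_zero s.2))
  have hκu : ∀ s : A⁰, IsUnit (((κ : A →* Q).comp A⁰.subtype) s) := fun s =>
    isUnit_iff_ne_zero.2 ((map_ne_zero_iff κ hκ).2 (nonZeroDivisors.ne_zero s.2))
  let f : OreLocalization A⁰ A →+* F :=
    OreLocalization.universalHom (ι : A →+* F) (IsUnit.liftRight _ hιu) fun s =>
      (IsUnit.coe_liftRight _ hιu s).symm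
  let g : OreLocalization A⁰ A →+* Q :=
    OreLocalization.universalHom (κ : A →+* Q) (IsUnit.liftRight _ hκu) fun s =>
      (IsUnit.coe_liftRight _ hκu s).symm
  have hf : ∀ a, f (OreLocalization.numeratorHom a) = ι a := fun a =>
    OreLocalization.universalHom_commutes _ _ _
  have hg : ∀ a, g (OreLocalization.numeratorHom a) = κ a := fun a =>
    OreLocalization.universalHom_commutes _ _ _
  -- Since F consists of fractions, it is the Ore localisation itself; the extension is g ∘ f⁻¹.
  have hbij : Function.Bijective f := by
    refine ⟨f.injective, fun x => ?_⟩
    obtain ⟨a, s, -, rfl⟩ := hι.exists_fraction x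
    exact ⟨(OreLocalization.numeratorHom s)⁻¹ * OreLocalization.numeratorHom a, by
      rw [map_mul, map_inv₀, hf, hf]⟩
  let e := RingEquiv.ofBijective f hbij
  have hρ : ∀ a, g (e.symm (ι a)) = κ a := fun a => by
    rw [← hg, ← hf]
    exact congrArg g (e.symm_apply_apply (OreLocalization.numeratorHom a))
  refine ⟨{ g.comp (e.symm : F →+* OreLocalization A⁰ A) with commutes' := fun r => ?_ }, hρ⟩
  have := hρ (algebraMap K A r)
  rwa [AlgHom.commutes, AlgHom.commutes] at this

end Fractions

/-! ### The deleting derivations algorithm in the quantum torus -/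

section Algorithm

variable {K : Type u} [Field K] {q : K}

/-- The element `E_{1,4}` in the quantum torus. -/
def e14 (hq0 : q ≠ 0) : Torus hq0 :=
  mono hq0 1 0 0 0 0 0 + ((q ^ 4 + q ^ 2 + 1) / (q ^ 2 - 1)) • mono hq0 0 1 (-1) 0 0 0

/-- The element `E_{1,5}` in the quantum torus. -/
def e15 (hq0 : q ≠ 0) : Torus hq0 :=
  e14 hq0 + (q ^ 6 / (q ^ 4 + q ^ 2 + 1)) • mono hq0 0 0 2 (-1) 0 0

/-- The element `E_{1,6}` in the quantum torus. -/
def e16 (hq0 : q ≠ 0) : Torus hq0 :=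
  e15 hq0 + (q * (q ^ 2 + 1) / (q ^ 2 - 1)) • mono hq0 0 0 1 0 (-1) 0
    + (q ^ 3 * (q ^ 4 + q ^ 2 + 1) / (q ^ 2 - 1) ^ 2) • mono hq0 0 0 0 1 (-2) 0

/-- The element `E_{2,5}` in the quantum torus. -/
def e25 (hq0 : q ≠ 0) : Torus hq0 :=
  mono hq0 0 1 0 0 0 0
    + (q ^ 9 * (q ^ 2 - 1) / (q ^ 4 + q ^ 2 + 1) ^ 2) • mono hq0 0 0 3 (-1) 0 0

/-- The element `E_{2,6}` in the quantum torus. -/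
def e26 (hq0 : q ≠ 0) : Torus hq0 :=
  e25 hq0 + q ^ 2 • mono hq0 0 0 2 0 (-1) 0
    + (q ^ 2 * (q ^ 4 + q ^ 2 + 1) / (q ^ 2 - 1)) • mono hq0 0 0 1 1 (-2) 0
    + (q ^ 9 * (q ^ 4 + q ^ 2 + 1) / (q ^ 2 - 1) ^ 2) • mono hq0 0 0 0 2 (-3) 0

/-- The element `E_{3,6}` in the quantum torus. -/
def e36 (hq0 : q ≠ 0) : Torus hq0 :=
  mono hq0 0 0 1 0 0 0 + ((q ^ 4 + q ^ 2 + 1) / (q ^ 2 - 1)) • mono hq0 0 0 0 1 (-1) 0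

/-- Each step clears the monomials with a negative power of one variable: T₆ here, then T₅, T₄ and
T₃ in the later steps. -/
theorem ddaStep6_x1 (hq0 : q ≠ 0) (hq : ∀ n : ℕ, 0 < n → q ^ n ≠ 1) :
    e1 hq0 + cR q • (e5 hq0 * mono hq0 0 0 0 0 0 (-1)) = e16 hq0 := by
  have hW := cyclotomic_ne_zero_horner hq
  have hD := sq_sub_one_ne_zero hq
  simp only [cR_eq hq0 hq, e1, e5, e14, e15, e16, pow_succ (_ : Torus hq0),
    pow_zero (_ : Torus hq0), one_mul, add_mul, mul_add, smul_mul_assoc, mul_smul_comm, mono_mul]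
  norm_num [zpow_neg]

theorem ddaStep6_x2 (hq0 : q ≠ 0) (hq : ∀ n : ℕ, 0 < n → q ^ n ≠ 1) :
    e2 hq0 + cT q • (e3 hq0 * e5 hq0 * mono hq0 0 0 0 0 0 (-1))
      + cU q • (e4 hq0 * mono hq0 0 0 0 0 0 (-1))
      + cN q • (e5 hq0 ^ 3 * mono hq0 0 0 0 0 0 (-1) ^ 2) = e26 hq0 := by
  have hW := cyclotomic_ne_zero_horner hq
  have hD := sq_sub_one_ne_zero hq
  simp only [cT_eq hq0 hq, cU_eq hq0 hq, cN, e2, e3, e4, e5, e25, e26, pow_succ (_ : Torus hq0),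
    pow_zero (_ : Torus hq0), one_mul, add_mul, mul_add, smul_mul_assoc, mul_smul_comm, mono_mul]
  norm_num [zpow_neg]
  match_scalars <;> field_simp <;> ring

theorem ddaStep6_x3 (hq0 : q ≠ 0) (hq : ∀ n : ℕ, 0 < n → q ^ n ≠ 1) :
    e3 hq0 + cS q • (e5 hq0 ^ 2 * mono hq0 0 0 0 0 0 (-1)) = e36 hq0 := by
  have hW := cyclotomic_ne_zero_horner hq
  have hD := sq_sub_one_ne_zero hq
  simp only [cS_eq hq0 hq, e3, e5, e36, pow_succ (_ : Torus hq0),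
    pow_zero (_ : Torus hq0), one_mul, add_mul, mul_add, smul_mul_assoc, mul_smul_comm, mono_mul]
  norm_num [zpow_neg]

theorem ddaStep6_x4 (hq0 : q ≠ 0) (hq : ∀ n : ℕ, 0 < n → q ^ n ≠ 1) :
    e4 hq0 + cB q • (e5 hq0 ^ 3 * mono hq0 0 0 0 0 0 (-1)) = mono hq0 0 0 0 1 0 0 := by
  have hW := cyclotomic_ne_zero_horner hq
  have hD := sq_sub_one_ne_zero hq
  simp only [cB_eq hq0 hq, e4, e5, pow_succ (_ : Torus hq0),
    pow_zero (_ : Torus hq0), one_mul, add_mul, mul_add, smul_mul_assoc, mul_smul_comm, mono_mul]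
  norm_num [zpow_neg]

theorem ddaStep5_x1 (hq0 : q ≠ 0) (hq : ∀ n : ℕ, 0 < n → q ^ n ≠ 1) :
    e16 hq0 + cH q • (e36 hq0 * mono hq0 0 0 0 0 (-1) 0)
      + cG q • (mono hq0 0 0 0 1 0 0 * mono hq0 0 0 0 0 (-1) 0 ^ 2) = e15 hq0 := by
  have hW := cyclotomic_ne_zero_horner hq
  have hD := sq_sub_one_ne_zero hq
  simp only [cH_eq hq0, cG_eq hq0 hq, e16, e15, e14, e36, pow_succ (_ : Torus hq0),
    pow_zero (_ : Torus hq0), one_mul, add_mul, mul_add, smul_mul_assoc, mul_smul_comm, mono_mul]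
  norm_num [zpow_neg]
  match_scalars <;> field_simp <;> ring

theorem ddaStep5_x2 (hq0 : q ≠ 0) (hq : ∀ n : ℕ, 0 < n → q ^ n ≠ 1) :
    e26 hq0 + cF q • (e36 hq0 ^ 2 * mono hq0 0 0 0 0 (-1) 0)
      + cP q • (e36 hq0 * mono hq0 0 0 0 1 0 0 * mono hq0 0 0 0 0 (-1) 0 ^ 2)
      + cE q • (mono hq0 0 0 0 1 0 0 ^ 2 * mono hq0 0 0 0 0 (-1) 0 ^ 3) = e25 hq0 := by
  have hW := cyclotomic_ne_zero_horner hq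
  have hD := sq_sub_one_ne_zero hq
  simp only [cF_eq hq0 hq, cP, cE_eq hq, e26, e25, e36, pow_succ (_ : Torus hq0),
    pow_zero (_ : Torus hq0), one_mul, add_mul, mul_add, smul_mul_assoc, mul_smul_comm, mono_mul]
  norm_num [zpow_neg]
  match_scalars <;> field_simp <;> ring

theorem ddaStep5_x3 (hq0 : q ≠ 0) (hq : ∀ n : ℕ, 0 < n → q ^ n ≠ 1) :
    e36 hq0 + cA q • (mono hq0 0 0 0 1 0 0 * mono hq0 0 0 0 0 (-1) 0) = mono hq0 0 0 1 0 0 0 := by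
  have hW := cyclotomic_ne_zero_horner hq
  have hD := sq_sub_one_ne_zero hq
  simp only [cA_eq hq0, e36, pow_succ (_ : Torus hq0),
    pow_zero (_ : Torus hq0), one_mul, add_mul, mul_add, smul_mul_assoc, mul_smul_comm, mono_mul]
  norm_num [zpow_neg]

theorem ddaStep4_x1 (hq0 : q ≠ 0) (hq : ∀ n : ℕ, 0 < n → q ^ n ≠ 1) :
    e15 hq0 + cS q • (mono hq0 0 0 1 0 0 0 ^ 2 * mono hq0 0 0 0 (-1) 0 0) = e14 hq0 := by
  have hW := cyclotomic_ne_zero_horner hq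
  have hD := sq_sub_one_ne_zero hq
  simp only [cS_eq hq0 hq, e15, e14, pow_succ (_ : Torus hq0),
    pow_zero (_ : Torus hq0), one_mul, add_mul, mul_add, smul_mul_assoc, mul_smul_comm, mono_mul]
  norm_num [zpow_neg]

theorem ddaStep4_x2 (hq0 : q ≠ 0) (hq : ∀ n : ℕ, 0 < n → q ^ n ≠ 1) :
    e25 hq0 + cB q • (mono hq0 0 0 1 0 0 0 ^ 3 * mono hq0 0 0 0 (-1) 0 0)
      = mono hq0 0 1 0 0 0 0 := by
  have hW := cyclotomic_ne_zero_horner hq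
  have hD := sq_sub_one_ne_zero hq
  simp only [cB_eq hq0 hq, e25, pow_succ (_ : Torus hq0),
    pow_zero (_ : Torus hq0), one_mul, add_mul, mul_add, smul_mul_assoc, mul_smul_comm, mono_mul]
  norm_num [zpow_neg]

theorem ddaStep3_x1 (hq0 : q ≠ 0) (hq : ∀ n : ℕ, 0 < n → q ^ n ≠ 1) :
    e14 hq0 + cA q • (mono hq0 0 1 0 0 0 0 * mono hq0 0 0 (-1) 0 0 0) = mono hq0 1 0 0 0 0 0 := by
  have hW := cyclotomic_ne_zero_horner hq
  have hD := sq_sub_one_ne_zero hq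
  simp only [cA_eq hq0, e14, pow_succ (_ : Torus hq0),
    pow_zero (_ : Torus hq0), one_mul, add_mul, mul_add, smul_mul_assoc, mul_smul_comm, mono_mul]
  norm_num [zpow_neg]

variable {Q : Type w} [DivisionRing Q] [Algebra K Q] (hq0 : q ≠ 0)
  (hq : ∀ n : ℕ, 0 < n → q ^ n ≠ 1) (j : Torus hq0 →ₐ[K] Q)

theorem map_mono_inv {a b c d e f a' b' c' d' e' f' : ℤ}
    (h : mono hq0 a b c d e f * mono hq0 a' b' c' d' e' f' = 1) :
    (j (mono hq0 a b c d e f))⁻¹ = j (mono hq0 a' b' c' d' e' f') :=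
  inv_eq_of_mul_eq_one_right (by rw [← map_mul, h, map_one])

theorem map_T6_inv : (j (mono hq0 0 0 0 0 0 1))⁻¹ = j (mono hq0 0 0 0 0 0 (-1)) :=
  map_mono_inv hq0 j (by rw [mono_mul, ← mono_zero]; norm_num)

theorem map_T5_inv : (j (mono hq0 0 0 0 0 1 0))⁻¹ = j (mono hq0 0 0 0 0 (-1) 0) :=
  map_mono_inv hq0 j (by rw [mono_mul, ← mono_zero]; norm_num)

theorem map_T4_inv : (j (mono hq0 0 0 0 1 0 0))⁻¹ = j (mono hq0 0 0 0 (-1) 0 0) :=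
  map_mono_inv hq0 j (by rw [mono_mul, ← mono_zero]; norm_num)

theorem map_T3_inv : (j (mono hq0 0 0 1 0 0 0))⁻¹ = j (mono hq0 0 0 (-1) 0 0 0) :=
  map_mono_inv hq0 j (by rw [mono_mul, ← mono_zero]; norm_num)

/-- In a division ring containing the quantum torus, the deleting derivations algorithm returns
the generators of the torus. -/
theorem ddaT_comp_toTorus :
    ddaT q (j.comp (toTorus hq0 hq)) =
      ⟨j (mono hq0 1 0 0 0 0 0), j (mono hq0 0 1 0 0 0 0), j (mono hq0 0 0 1 0 0 0),
        j (mono hq0 0 0 0 1 0 0), j (mono hq0 0 0 0 0 1 0), j (mono hq0 0 0 0 0 0 1)⟩ := by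
  have h7 : dda7 q (j.comp (toTorus hq0 hq)) =
      ⟨j (e1 hq0), j (e2 hq0), j (e3 hq0), j (e4 hq0), j (e5 hq0), j (e6 hq0)⟩ := by
    simp only [dda7, AlgHom.comp_apply, toTorus_E1, toTorus_E2, toTorus_E3, toTorus_E4,
      toTorus_E5, toTorus_E6]
  have h6 : ddaStep6 q (dda7 q (j.comp (toTorus hq0 hq))) =
      ⟨j (e16 hq0), j (e26 hq0), j (e36 hq0), j (mono hq0 0 0 0 1 0 0), j (e5 hq0),
        j (e6 hq0)⟩ := by
    have hinv : (j (e6 hq0))⁻¹ = j (mono hq0 0 0 0 0 0 (-1)) := map_T6_inv hq0 j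
    rw [h7, ddaStep6]
    simp only [hinv, ← map_mul, ← map_pow, ← map_smul, ← map_add, ddaStep6_x1 hq0 hq,
      ddaStep6_x2 hq0 hq, ddaStep6_x3 hq0 hq, ddaStep6_x4 hq0 hq]
  have h5 : ddaStep5 q (ddaStep6 q (dda7 q (j.comp (toTorus hq0 hq)))) =
      ⟨j (e15 hq0), j (e25 hq0), j (mono hq0 0 0 1 0 0 0), j (mono hq0 0 0 0 1 0 0), j (e5 hq0),
        j (e6 hq0)⟩ := by
    have hinv : (j (e5 hq0))⁻¹ = j (mono hq0 0 0 0 0 (-1) 0) := map_T5_inv hq0 j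
    rw [h6, ddaStep5]
    simp only [hinv, ← map_mul, ← map_pow, ← map_smul, ← map_add, ddaStep5_x1 hq0 hq,
      ddaStep5_x2 hq0 hq, ddaStep5_x3 hq0 hq]
  have h4 : ddaStep4 q (ddaStep5 q (ddaStep6 q (dda7 q (j.comp (toTorus hq0 hq))))) =
      ⟨j (e14 hq0), j (mono hq0 0 1 0 0 0 0), j (mono hq0 0 0 1 0 0 0), j (mono hq0 0 0 0 1 0 0),
        j (e5 hq0), j (e6 hq0)⟩ := by
    rw [h5, ddaStep4]
    simp only [map_T4_inv, ← map_mul, ← map_pow, ← map_smul, ← map_add, ddaStep4_x1 hq0 hq,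
      ddaStep4_x2 hq0 hq]
  rw [ddaT, h4, ddaStep3]
  simp only [map_T3_inv, ← map_mul, ← map_smul, ← map_add, ddaStep3_x1 hq0 hq]
  rfl

theorem mono_odd : mono hq0 1 0 0 0 0 0 * mono hq0 0 0 1 0 0 0 * mono hq0 0 0 0 0 1 0
    = mono hq0 1 0 1 0 1 0 := by
  simp only [mono_mul, smul_mul_assoc]
  norm_num

theorem mono_even : mono hq0 0 1 0 0 0 0 * mono hq0 0 0 0 1 0 0 * mono hq0 0 0 0 0 0 1
    = mono hq0 0 1 0 1 0 1 := by
  simp only [mono_mul, smul_mul_assoc]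
  norm_num

/-- The deleting derivations algorithm is compatible with homomorphisms of division rings. -/
theorem map_ddaT {F : Type v} [DivisionRing F] [Algebra K F] (ρ : F →ₐ[K] Q)
    (ι : UqPlus q →ₐ[K] F) : ddaT q (ρ.comp ι) =
      ⟨ρ (ddaT q ι).x1, ρ (ddaT q ι).x2, ρ (ddaT q ι).x3, ρ (ddaT q ι).x4, ρ (ddaT q ι).x5,
        ρ (ddaT q ι).x6⟩ := by
  simp only [ddaT, ddaStep3, ddaStep4, ddaStep5, ddaStep6, dda7, AlgHom.comp_apply, map_add,
    map_mul, map_smul, map_pow, map_inv₀]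

/-! ### The skew field of fractions of U_q^+(G₂) and the product formulas. -/

theorem noZeroDivisors_uqPlus (hq0 : q ≠ 0) (hq : ∀ n : ℕ, 0 < n → q ^ n ≠ 1) :
    NoZeroDivisors (UqPlus q) :=
  (toTorus_injective hq0 hq).noZeroDivisors _ (map_zero _) (map_mul _)

theorem nontrivial_uqPlus (hq0 : q ≠ 0) (hq : ∀ n : ℕ, 0 < n → q ^ n ≠ 1) :
    Nontrivial (UqPlus q) :=
  (toTorus hq0 hq).toRingHom.domain_nontrivial

theorem exists_skewField (hq0 : q ≠ 0) (hq : ∀ n : ℕ, 0 < n → q ^ n ≠ 1) :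
    ∃ (F : Type u) (_ : DivisionRing F) (_ : Algebra K F) (ι : UqPlus q →ₐ[K] F),
      IsSkewFieldOfFractions ι := by
  have := noZeroDivisors_uqPlus hq0 hq
  have := nontrivial_uqPlus hq0 hq
  exact exists_isSkewFieldOfFractions (exists_mul_eq_mul (toTorus_injective hq0 hq))

theorem omega_eq_prod (hq0 : q ≠ 0) (hq : ∀ n : ℕ, 0 < n → q ^ n ≠ 1)
    {F : Type v} [DivisionRing F] [Algebra K F] (ι : UqPlus q →ₐ[K] F)
    (hι : IsSkewFieldOfFractions ι) :
    ι (Omega1 q) = (ddaT q ι).x1 * (ddaT q ι).x3 * (ddaT q ι).x5 ∧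
      ι (Omega2 q) = (ddaT q ι).x2 * (ddaT q ι).x4 * (ddaT q ι).x6 := by
  have := noZeroDivisors_uqPlus hq0 hq
  have := nontrivial_uqPlus hq0 hq
  obtain ⟨Q, _, _, j, hj⟩ := exists_isSkewFieldOfFractions (K := K) (A := Torus hq0)
    (exists_mul_eq_mul (φ := AlgHom.id K _) Function.injective_id)
  obtain ⟨ρ, hρ⟩ := hι.exists_extension (κ := j.comp (toTorus hq0 hq))
    (exists_mul_eq_mul (toTorus_injective hq0 hq))
    (hj.injective.comp (toTorus_injective hq0 hq))
  -- Running the algorithm in F and then applying ρ is the same as running it in the fractions of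
  -- the torus. There the elements inverted are nonzero monomials, so all inverses are genuine; ρ is
  -- injective, so identities descend to F.
  have hcomp : ρ.comp ι = j.comp (toTorus hq0 hq) := AlgHom.ext hρ
  have hdda := (map_ddaT ρ ι).symm.trans ((congrArg (ddaT q) hcomp).trans
    (ddaT_comp_toTorus hq0 hq j))
  rw [Sextuple.mk.injEq] at hdda
  obtain ⟨h1, h2, h3, h4, h5, h6⟩ := hdda
  constructor
  · apply ρ.toRingHom.injective
    change ρ _ = ρ _
    rw [map_mul, map_mul, h1, h3, h5, hρ, AlgHom.comp_apply, toTorus_Omega1, ← map_mul, ← map_mul,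
      mono_odd]
  · apply ρ.toRingHom.injective
    change ρ _ = ρ _
    rw [map_mul, map_mul, h2, h4, h6, hρ, AlgHom.comp_apply, toTorus_Omega2, ← map_mul, ← map_mul,
      mono_even]

end Algorithm

/-! ### The centre -/

namespace QuantumTorus

variable {K : Type u} [Field K] {G : Type v} [AddCommGroup G] {q : Kˣ} {B : G →+ G →+ ℤ}

theorem X_add (g h : G) :
    X q B (g + h) = ((q ^ (-B g h) : Kˣ) : K) • (X q B g * X q B h) := by
  rw [X_mul_X, smul_smul, ← Units.val_mul, ← zpow_add, neg_add_cancel, zpow_zero, Units.val_one,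
    one_smul]

/-- The exponents of the monomials commuting with a given element. -/
def commutingExponents (f : QuantumTorus q B) : AddSubgroup G where
  carrier := {g | Commute f (X q B g)}
  zero_mem' := by
    change Commute f (X q B 0)
    rw [← one_def]
    exact Commute.one_right f
  add_mem' {g h} hg hh := by
    change Commute f (X q B (g + h))
    rw [X_add]
    exact (Commute.mul_right hg hh).smul_right _
  neg_mem' {g} hg := by
    -- X g * X (-g) is q ^ (-B g g), which dictates the scalar in the inverse.
    have hu : X q B g * (((q ^ B g g : Kˣ) : K) • X q B (-g)) = 1 := by
      rw [mul_smul_comm, X_mul_X, smul_smul, ← Units.val_mul, ← zpow_add, map_neg, add_neg_cancel,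
        zpow_zero, Units.val_one, one_smul, add_neg_cancel, one_def]
    have hu' : (((q ^ B g g : Kˣ) : K) • X q B (-g)) * X q B g = 1 := by
      rw [smul_mul_assoc, X_mul_X, smul_smul, ← Units.val_mul, ← zpow_add, map_neg,
        AddMonoidHom.neg_apply, add_neg_cancel, zpow_zero, Units.val_one, one_smul,
        neg_add_cancel, one_def]
    have h1 : Commute f (((q ^ B g g : Kˣ) : K) • X q B (-g)) :=
      Commute.units_inv_right (u := ⟨X q B g, _, hu, hu'⟩) hg
    have h2 := h1.smul_right ((q ^ B g g : Kˣ) : K)⁻¹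
    rwa [inv_smul_smul₀ (Units.ne_zero _)] at h2

theorem mem_commutingExponents {f : QuantumTorus q B} {g : G} :
    g ∈ commutingExponents f ↔ Commute f (X q B g) := Iff.rfl

theorem commute_X_of_form_eq {h : G} (hB : ∀ g, B g h = B h g) (f : QuantumTorus q B) :
    Commute f (X q B h) := by
  induction f using induction with
  | zero => exact Commute.zero_left _
  | add f g hf hg => exact hf.add_left hg
  | smul c f hf => exact hf.smul_left c
  | X g => rw [commute_iff_eq, X_mul_X, X_mul_X, hB, add_comm]

theorem X_pow (g : G) (n : ℕ) : ∃ c : Kˣ, X q B g ^ n = (c : K) • X q B (n • g) := by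
  induction n with
  | zero => exact ⟨1, by simp [one_def]⟩
  | succ n ih =>
    obtain ⟨c, hc⟩ := ih
    refine ⟨c * q ^ B (n • g) g, ?_⟩
    rw [pow_succ, hc, smul_mul_assoc, X_mul_X, smul_smul, succ_nsmul, Units.val_mul]

end QuantumTorus

/-! ### Central elements, their exponents, and algebraic independence. -/

section Centre

variable {K : Type u} [Field K] {q : K}

theorem expo_eq (a b c d e f : ℤ) : expo a b c d e f =
    a • expo 1 0 0 0 0 0 + (b • expo 0 1 0 0 0 0 + (c • expo 0 0 1 0 0 0 + (d • expo 0 0 0 1 0 0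
      + (e • expo 0 0 0 0 1 0 + f • expo 0 0 0 0 0 1)))) := by
  simp only [zsmul_expo, expo_add, mul_one, mul_zero, add_zero, zero_add]

theorem expo_ofLex (g : Exponent) :
    g = expo (ofLex g 0) (ofLex g 1) (ofLex g 2) (ofLex g 3) (ofLex g 4) (ofLex g 5) := by
  refine ofLex.injective (funext fun i => ?_)
  fin_cases i <;> rfl

/-- An element of the torus commuting with the image of `U_q^+(G_2)` commutes with all Laurent
monomials. -/
theorem mem_commutingExponents_of_commute (hq0 : q ≠ 0) {x : Torus hq0}
    (h1 : Commute x (e1 hq0)) (h2 : Commute x (e2 hq0)) (h3 : Commute x (e3 hq0))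
    (h4 : Commute x (e4 hq0)) (h5 : Commute x (e5 hq0)) (h6 : Commute x (e6 hq0))
    (g : Exponent) : g ∈ commutingExponents x := by
  set H := commutingExponents x
  -- The variables are recovered from T₆ down to T₁: e₆ and e₅ are monomials, and each earlier eᵢ is
  -- Tᵢ plus Laurent monomials in variables already known to commute with x.
  have m6 : expo 0 0 0 0 0 1 ∈ H := h6
  have m5 : expo 0 0 0 0 1 0 ∈ H := h5
  have s4 : ∀ e f, Commute x (mono hq0 0 0 0 0 e f) := fun e f =>
    show expo 0 0 0 0 e f ∈ H by
      rw [expo_eq]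
      simpa using add_mem (zsmul_mem m5 e) (zsmul_mem m6 f)
  have m4 : expo 0 0 0 1 0 0 ∈ H := by
    have := h4.sub_right ((s4 3 (-1)).smul_right
      (q ^ 9 * (q ^ 2 - 1) / (q ^ 4 + q ^ 2 + 1) ^ 2))
    rwa [e4, add_sub_cancel_right] at this
  have s3 : ∀ d e f, Commute x (mono hq0 0 0 0 d e f) := fun d e f =>
    show expo 0 0 0 d e f ∈ H by
      rw [expo_eq]
      simpa using add_mem (zsmul_mem m4 d) (add_mem (zsmul_mem m5 e) (zsmul_mem m6 f))
  have m3 : expo 0 0 1 0 0 0 ∈ H := by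
    have hr : Commute x (e3 hq0 - mono hq0 0 0 1 0 0 0) := by
      rw [e3, add_assoc, add_sub_cancel_left]
      exact ((s3 _ _ _).smul_right _).add_right ((s3 _ _ _).smul_right _)
    have := h3.sub_right hr
    rwa [sub_sub_cancel] at this
  have s2 : ∀ c d e f, Commute x (mono hq0 0 0 c d e f) := fun c d e f =>
    show expo 0 0 c d e f ∈ H by
      rw [expo_eq]
      simpa using add_mem (zsmul_mem m3 c) (add_mem (zsmul_mem m4 d)
        (add_mem (zsmul_mem m5 e) (zsmul_mem m6 f)))
  have m2 : expo 0 1 0 0 0 0 ∈ H := by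
    have hr : Commute x (e2 hq0 - mono hq0 0 1 0 0 0 0) := by
      simp only [e2, add_assoc, add_sub_cancel_left]
      repeat' apply Commute.add_right
      all_goals exact (s2 _ _ _ _).smul_right _
    have := h2.sub_right hr
    rwa [sub_sub_cancel] at this
  have s1 : ∀ b c d e f, Commute x (mono hq0 0 b c d e f) := fun b c d e f =>
    show expo 0 b c d e f ∈ H by
      rw [expo_eq]
      simpa using add_mem (zsmul_mem m2 b) (add_mem (zsmul_mem m3 c) (add_mem (zsmul_mem m4 d)
        (add_mem (zsmul_mem m5 e) (zsmul_mem m6 f))))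
  have m1 : expo 1 0 0 0 0 0 ∈ H := by
    have hr : Commute x (e1 hq0 - mono hq0 1 0 0 0 0 0) := by
      simp only [e1, add_assoc, add_sub_cancel_left]
      repeat' apply Commute.add_right
      all_goals exact (s1 _ _ _ _ _).smul_right _
    have := h1.sub_right hr
    rwa [sub_sub_cancel] at this
  rw [expo_ofLex g, expo_eq]
  exact add_mem (zsmul_mem m1 _) (add_mem (zsmul_mem m2 _) (add_mem (zsmul_mem m3 _)
    (add_mem (zsmul_mem m4 _) (add_mem (zsmul_mem m5 _) (zsmul_mem m6 _)))))

/-- The radical of the commutation form. -/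
theorem eq_expo_of_form_eq {g : Exponent} (h : ∀ k, form g k = form k g) :
    g = expo (ofLex g 0) (ofLex g 1) (ofLex g 0) (ofLex g 1) (ofLex g 0) (ofLex g 1) := by
  -- Testing against the six unit exponents gives a linear system whose solutions repeat the first
  -- two coordinates.
  have h1 := h (expo 1 0 0 0 0 0)
  have h2 := h (expo 0 1 0 0 0 0)
  have h3 := h (expo 0 0 1 0 0 0)
  have h4 := h (expo 0 0 0 1 0 0)
  have h5 := h (expo 0 0 0 0 1 0)
  have h6 := h (expo 0 0 0 0 0 1)
  rw [expo_ofLex g, form_expo, form_expo] at h1 h2 h3 h4 h5 h6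
  conv_lhs => rw [expo_ofLex g]
  congr 1 <;> linarith

theorem form_expo_comm (i j : ℤ) (g : Exponent) :
    form g (expo i j i j i j) = form (expo i j i j i j) g := by
  rw [expo_ofLex g, form_expo, form_expo]
  ring

theorem exists_toTorus_omega (hq0 : q ≠ 0) (hq : ∀ n : ℕ, 0 < n → q ^ n ≠ 1) (i j : ℕ) :
    ∃ c : Kˣ, toTorus hq0 hq (Omega1 q ^ i * Omega2 q ^ j) = (c : K) • mono hq0 i j i j i j := by
  obtain ⟨c, hc⟩ := X_pow (q := Units.mk0 q hq0) (B := form) (expo 1 0 1 0 1 0) i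
  obtain ⟨d, hd⟩ := X_pow (q := Units.mk0 q hq0) (B := form) (expo 0 1 0 1 0 1) j
  refine ⟨c * d * Units.mk0 q hq0 ^ form (i • expo 1 0 1 0 1 0) (j • expo 0 1 0 1 0 1), ?_⟩
  rw [map_mul, map_pow, map_pow, toTorus_Omega1, toTorus_Omega2, mono, mono, hc, hd,
    smul_mul_assoc, mul_smul_comm, X_mul_X, smul_smul, smul_smul, Units.val_mul, Units.val_mul,
    smul_expo, smul_expo, expo_add, mono, mul_assoc]
  simp only [mul_one, mul_zero, add_zero, zero_add]

variable (hq0 : q ≠ 0) (hq : ∀ n : ℕ, 0 < n → q ^ n ≠ 1)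

theorem mem_center_of_toTorus_eq {z : UqPlus q} {i j : ℤ}
    (hz : toTorus hq0 hq z = mono hq0 i j i j i j) : z ∈ Subalgebra.center K (UqPlus q) := by
  rw [Subalgebra.mem_center_iff]
  intro w
  apply toTorus_injective hq0 hq
  rw [map_mul, map_mul, hz]
  exact commute_X_of_form_eq (form_expo_comm i j) _

/-- Commuting with the six images forces commuting with every Laurent monomial, and then each
exponent of the support is orthogonal to everything because q is not a root of unity. -/
theorem form_eq_of_mem_center {z : UqPlus q} (hz : z ∈ Subalgebra.center K (UqPlus q))
    {g : Exponent} (hg : coeff g (toTorus hq0 hq z) ≠ 0) (k : Exponent) :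
    form g k = form k g := by
  have hc : ∀ w, Commute (toTorus hq0 hq z) (toTorus hq0 hq w) := fun w => by
    rw [commute_iff_eq, ← map_mul, ← map_mul, (Subalgebra.mem_center_iff.1 hz) w]
  refine form_eq_of_commute hq (mem_commutingExponents.1 ?_) hg
  exact mem_commutingExponents_of_commute hq0 (toTorus_E1 hq0 hq ▸ hc _)
    (toTorus_E2 hq0 hq ▸ hc _) (toTorus_E3 hq0 hq ▸ hc _) (toTorus_E4 hq0 hq ▸ hc _)
    (toTorus_E5 hq0 hq ▸ hc _) (toTorus_E6 hq0 hq ▸ hc _) k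

theorem adjoin_omega_le_center (hq0 : q ≠ 0) (hq : ∀ n : ℕ, 0 < n → q ^ n ≠ 1) :
    Algebra.adjoin K {Omega1 q, Omega2 q} ≤ Subalgebra.center K (UqPlus q) := by
  refine Algebra.adjoin_le ?_
  rintro _ (rfl | rfl)
  · exact mem_center_of_toTorus_eq hq0 hq (toTorus_Omega1 hq0 hq)
  · exact mem_center_of_toTorus_eq hq0 hq (toTorus_Omega2 hq0 hq)

/-- Induction on the number of monomials in the image. The torus has central monomials with negative
exponents too; nonnegativity of the leading exponent is what makes it the exponent of an honest Ω₁^i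
Ω₂^j. -/
theorem center_le_adjoin_omega (hq0 : q ≠ 0) (hq : ∀ n : ℕ, 0 < n → q ^ n ≠ 1) :
    Subalgebra.center K (UqPlus q) ≤ Algebra.adjoin K {Omega1 q, Omega2 q} := by
  intro z hz
  induction hn : (supp (toTorus hq0 hq z)).card using Nat.strong_induction_on generalizing z with
  | _ n ih =>
  by_cases hz0 : z = 0
  · rw [hz0]; exact zero_mem _
  obtain ⟨p, hp⟩ := exists_hasLead_toTorus hq0 hq hz0
  have hexp : pbwExpo p = expo p.1 p.2.1 p.1 p.2.1 p.1 p.2.1 :=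
    eq_expo_of_form_eq (form_eq_of_mem_center hq0 hq hz hp.coeff_ne_zero)
  obtain ⟨c, hc⟩ := exists_toTorus_omega hq0 hq p.1 p.2.1
  have hmem : Omega1 q ^ p.1 * Omega2 q ^ p.2.1 ∈ Algebra.adjoin K {Omega1 q, Omega2 q} :=
    mul_mem (pow_mem (Algebra.subset_adjoin (by simp)) _)
      (pow_mem (Algebra.subset_adjoin (by simp)) _)
  obtain ⟨a, ha⟩ : ∃ a, a = coeff (pbwExpo p) (toTorus hq0 hq z) := ⟨_, rfl⟩
  obtain ⟨y, hy⟩ : ∃ y, y = (a * (c : K)⁻¹) • (Omega1 q ^ p.1 * Omega2 q ^ p.2.1) := ⟨_, rfl⟩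
  have hyadj : y ∈ Algebra.adjoin K {Omega1 q, Omega2 q} := hy ▸ Subalgebra.smul_mem _ hmem _
  have himg : toTorus hq0 hq (z - y) =
      toTorus hq0 hq z - a • X (Units.mk0 q hq0) form (pbwExpo p) := by
    rw [map_sub, hy, map_smul, hc, smul_smul, mul_assoc, inv_mul_cancel₀ c.ne_zero, mul_one, mono,
      hexp]
  -- The image of y is a single monomial, so subtraction removes the leading exponent and creates no
  -- new one.
  have hcard : (supp (toTorus hq0 hq (z - y))).card < n := by
    rw [← hn]
    refine Finset.card_lt_card (Finset.ssubset_iff_of_subset ?_ |>.2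
      ⟨pbwExpo p, mem_supp.2 hp.coeff_ne_zero, ?_⟩)
    · intro g hg
      rw [mem_supp, himg, map_sub, map_smul] at hg
      rw [mem_supp]
      intro hg0
      by_cases hgp : pbwExpo p = g
      · exact hp.coeff_ne_zero (hgp ▸ hg0)
      · rw [hg0, coeff_X_of_ne hgp, smul_zero, sub_zero] at hg
        exact hg rfl
    · rw [mem_supp, himg, map_sub, map_smul, coeff_X_self, ← ha, smul_eq_mul, mul_one, sub_self]
      exact fun h => h rfl
  have hfin := ih _ hcard (sub_mem hz (adjoin_omega_le_center hq0 hq hyadj)) rfl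
  have := add_mem hfin hyadj
  rwa [sub_add_cancel] at this

theorem center_eq_adjoin_omega (hq0 : q ≠ 0) (hq : ∀ n : ℕ, 0 < n → q ^ n ≠ 1) :
    Subalgebra.center K (UqPlus q) = Algebra.adjoin K {Omega1 q, Omega2 q} :=
  le_antisymm (center_le_adjoin_omega hq0 hq) (adjoin_omega_le_center hq0 hq)

/-- `Ω₁` and `Ω₂` as elements of the centre. -/
def omega : Fin 2 → Subalgebra.center K (UqPlus q) :=
  ![⟨Omega1 q, mem_center_of_toTorus_eq hq0 hq (toTorus_Omega1 hq0 hq)⟩,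
    ⟨Omega2 q, mem_center_of_toTorus_eq hq0 hq (toTorus_Omega2 hq0 hq)⟩]

/-- The monomials in Ω₁ and Ω₂ have distinct leading exponents in the torus, so no nontrivial
combination of them vanishes. -/
theorem aeval_omega_injective :
    Function.Injective (MvPolynomial.aeval (R := K) (omega hq0 hq)) := by
  rw [injective_iff_map_eq_zero]
  intro p hp
  by_contra hne
  let b := MvPolynomial.basisMonomials (Fin 2) K
  let f : MvPolynomial (Fin 2) K →ₗ[K] Torus hq0 :=
    (toTorus hq0 hq : UqPlus q →ₗ[K] Torus hq0).comp
      ((Subalgebra.center K (UqPlus q)).val.toLinearMap.comp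
        (MvPolynomial.aeval (R := K) (omega hq0 hq)).toLinearMap)
  have hf : f p = 0 := by
    change toTorus hq0 hq ((MvPolynomial.aeval (R := K) (omega hq0 hq) p : _) : UqPlus q) = 0
    rw [hp]
    exact map_zero _
  have hb : ∀ m : Fin 2 →₀ ℕ, HasLead (f (b m)) (expo (m 0) (m 1) (m 0) (m 1) (m 0) (m 1)) := by
    intro m
    have hfm : f (b m) = toTorus hq0 hq (Omega1 q ^ m 0 * Omega2 q ^ m 1) := by
      change toTorus hq0 hq ((MvPolynomial.aeval (R := K) (omega hq0 hq) (b m) : _) : UqPlus q) = _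
      congr 1
      rw [MvPolynomial.coe_basisMonomials, MvPolynomial.aeval_monomial, map_one, one_mul,
        Finsupp.prod_fintype _ _ (fun _ => pow_zero _), Fin.prod_univ_two]
      rfl
    obtain ⟨c, hc⟩ := exists_toTorus_omega hq0 hq (m 0) (m 1)
    rw [hfm, hc, ← add_zero ((c : K) • _)]
    exact hasLead_smul_X_add c.ne_zero (zero_mem _)
  have hinj : Function.Injective fun m : Fin 2 →₀ ℕ =>
      expo (m 0) (m 1) (m 0) (m 1) (m 0) (m 1) := by
    intro m m' h
    obtain ⟨h0, h1, -⟩ := expo_inj h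
    ext i
    fin_cases i
    · exact_mod_cast h0
    · exact_mod_cast h1
  obtain ⟨m, hm⟩ := exists_hasLead_linearCombination hinj hb
    (c := b.repr p) (by rwa [Ne, LinearEquiv.map_eq_zero_iff])
  have hlc : Finsupp.linearCombination K (fun m => f (b m)) (b.repr p) = f p := by
    conv_rhs => rw [← b.linearCombination_repr p]
    rw [Finsupp.apply_linearCombination]
    rfl
  rw [hlc, hf] at hm
  exact hm.ne_zero rfl

theorem aeval_omega_surjective :
    Function.Surjective (MvPolynomial.aeval (R := K) (omega hq0 hq)) := by
  have h : Algebra.adjoin K {Omega1 q, Omega2 q} ≤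
      ((MvPolynomial.aeval (R := K) (omega hq0 hq)).range).map
        (Subalgebra.center K (UqPlus q)).val := by
    refine Algebra.adjoin_le ?_
    rintro _ (rfl | rfl)
    · exact ⟨_, ⟨MvPolynomial.X 0, MvPolynomial.aeval_X _ _⟩, rfl⟩
    · exact ⟨_, ⟨MvPolynomial.X 1, MvPolynomial.aeval_X _ _⟩, rfl⟩
  intro z
  obtain ⟨y, ⟨p, hp⟩, hy⟩ := h (center_le_adjoin_omega hq0 hq z.2)
  exact ⟨p, hp.trans (Subtype.ext hy)⟩

theorem exists_mvPolynomial_equiv_center (hq0 : q ≠ 0) (hq : ∀ n : ℕ, 0 < n → q ^ n ≠ 1) :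
    ∃ e : MvPolynomial (Fin 2) K ≃ₐ[K] Subalgebra.center K (UqPlus q),
      (e (MvPolynomial.X 0) : UqPlus q) = Omega1 q ∧
      (e (MvPolynomial.X 1) : UqPlus q) = Omega2 q :=
  ⟨AlgEquiv.ofBijective (MvPolynomial.aeval (R := K) (omega hq0 hq))
      ⟨aeval_omega_injective hq0 hq, aeval_omega_surjective hq0 hq⟩,
    congrArg Subtype.val (MvPolynomial.aeval_X (R := K) (omega hq0 hq) 0),
    congrArg Subtype.val (MvPolynomial.aeval_X (R := K) (omega hq0 hq) 1)⟩

end Centre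

end QG2

end

theorem mainTheorem8 {K : Type u} [Field K] (q : K) (hq0 : q ≠ 0)
    (hq : ∀ n : ℕ, 0 < n → q ^ n ≠ 1) :
    -- the centre is generated by `Ω₁` and `Ω₂` ...
    Subalgebra.center K (QG2.UqPlus q) =
        Algebra.adjoin K {QG2.Omega1 q, QG2.Omega2 q} ∧
    -- ... and it is a polynomial algebra in `Ω₁` and `Ω₂`
    (∃ e : MvPolynomial (Fin 2) K ≃ₐ[K] Subalgebra.center K (QG2.UqPlus q),
      (e (MvPolynomial.X 0) : QG2.UqPlus q) = QG2.Omega1 q ∧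
      (e (MvPolynomial.X 1) : QG2.UqPlus q) = QG2.Omega2 q) ∧
    -- the skew field of fractions exists, and in it `Ω₁ = T₁T₃T₅` and `Ω₂ = T₂T₄T₆`
    (∃ (F : Type u) (_ : DivisionRing F) (_ : Algebra K F) (ι : QG2.UqPlus q →ₐ[K] F),
      QG2.IsSkewFieldOfFractions ι) ∧
    (∀ (F : Type v) [DivisionRing F] [Algebra K F] (ι : QG2.UqPlus q →ₐ[K] F),
      QG2.IsSkewFieldOfFractions ι →
        ι (QG2.Omega1 q) = (QG2.ddaT q ι).x1 * (QG2.ddaT q ι).x3 * (QG2.ddaT q ι).x5 ∧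
        ι (QG2.Omega2 q) = (QG2.ddaT q ι).x2 * (QG2.ddaT q ι).x4 * (QG2.ddaT q ι).x6) :=
  ⟨QG2.center_eq_adjoin_omega hq0 hq, QG2.exists_mvPolynomial_equiv_center hq0 hq,
    QG2.exists_skewField hq0 hq, fun _ _ _ ι hι => QG2.omega_eq_prod hq0 hq ι hι⟩
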